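/- **Imprimitivity theorem for well-behaved representations.** Setting. Let $G$ be a (discrete) group with unit $e$, $H\subseteq G$ a subgroup, and $\mathcal A=\bigoplus_{g\in G}\mathcal A_g$ a unital complex $G$-graded $*$-algebra ($\mathcal A_g\mathcal A_h\subseteq\mathcal A_{gh}$, $\mathcal A_g^*\subseteq\mathcal A_{g^{-1}}$) such that the $*$-subalgebra $\mathcal B=\mathcal A_e$ is commutative and countably generated. For $X\subseteq G$ put $\mathcal A_X=\bigoplus_{g\in X}\mathcal A_g$, and let $p_H:\mathcal A\to\mathcal A_H$, $p_H(\sum_g a_g)=\sum_{g\in H}a_g$, be the canonical conditional expectation. *Representations.* A $*$-representation $\pi$ of a $*$-algebra on a dense subspace $\mathcal D(\pi)$ of a Hilbert space $\mathcal H_\pi$ is an algebra homomorphism into the linear operators on $\mathcal D(\pi)$ with $\langle\pi(a)\varphi,\psi\rangle=\langle\varphi,\pi(a^*)\psi\rangle$. Its graph topology on $\mathcal D(\pi)$ is given by the norms $\|\varphi\|+\|\pi(a)\varphi\|$; $\pi$ is closed if $\mathcal D(\pi)$ is complete in this topology. A $*$-representation $\sigma$ of $\mathcal B$ is integrable if it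 is closed and $\overline{\sigma(b^*)}=\sigma(b)^*$ for all $b\in\mathcal B$. Two $*$-representations are unitarily equivalent if there is an isometric linear bijection of their domains that intertwines them. *Well-behaved representations.* Let $\widehat{\mathcal B}^+$ be the set of characters (nontrivial $*$-homomorphisms $\mathcal B\to\mathbb C$) that are nonnegative on $\sum\mathcal A^2\cap\mathcal B$, where $\sum\mathcal A^2$ denotes the finite sums of elements $a^*a$, $a\in\mathcal A$; it carries the weakest topology making all $\chi\mapsto\chi(b)$ continuous. For $\chi\in\widehat{\mathcal B}^+$ and $g\in G$, the character $\chi^g$ is defined if $\chi(a^*a)\ne0$ for some $a\in\mathcal A_g$, and then $\chi^g(b)=\chi(a^*ba)/\chi(a^*a)$. For $\Delta\subseteq\widehat{\mathcal B}^+$ let $\Delta^g$ be the set of all defined $\chi^g$ with $\chi\in\Delta$. Let $F$ be a subgroup of $G$. A $*$-representation $\pi$ of $\mathcal A_F$ is well-behaved if its restriction to $\mathcal B$ is integrable and there is a spectral measure $E_\pi$ on the Borel sets of $\widehat{\mathcal B}^+$ with $\overline{\pi(b)}=\int\chi(b)\,dE_\pi(\chi)$ for all $b\in\mathcal B$ and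 $E_\pi(\Delta^g)\pi(a_g)\subseteq\pi(a_g)E_\pi(\Delta)$ for all $g\in F$, $a_g\in\mathcal A_g$ and Borel sets $\Delta$. (The notion is used for $F=G$ and $F=H$.) *Systems of imprimitivity.* A system of imprimitivity for $\mathcal A$ over $G/H$ is a pair $(\pi,E)$ of a $*$-representation $\pi$ of $\mathcal A$ and a map $E$ from the set $G/H$ of left cosets to the orthogonal projections of $\mathcal H_\pi$ such that $E(s)E(t)=0$ for $s\ne t$, $\sum_tE(t)=I$ strongly, and $E(gt)\pi(a_g)\subseteq\pi(a_g)E(t)$ for all $g\in G$, $a_g\in\mathcal A_g$, $t\in G/H$. Put $\mathcal D_t(\pi)=\operatorname{Ran}E(t)\cap\mathcal D(\pi)$. The system is non-degenerate if for every $t\in G/H$ the linear span of $\pi(\mathcal A_t)\mathcal D_H(\pi)$ is dense in $\mathcal D_t(\pi)$ in the graph topology of $\pi$. It is well-behaved if $\pi$ is well-behaved and $E(t)E_\pi(\Delta)=E_\pi(\Delta)E(t)$ for all $t$ and all Borel sets $\Delta$. Two systems $(\pi,E)$, $(\pi',E')$ are unitarily equivalent if there is a unitary $U:\mathcal H_\pi\to\mathcal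 H_{\pi'}$ with $U\mathcal D(\pi)=\mathcal D(\pi')$, $U\pi(a)\varphi=\pi'(a)U\varphi$ and $UE(t)=E'(t)U$ for all $a\in\mathcal A$, $\varphi\in\mathcal D(\pi)$, $t\in G/H$. *Induction.* A $*$-representation $\rho$ of $\mathcal A_H$ is inducible if the Hermitian form determined by $\langle x\otimes\varphi,y\otimes\psi\rangle_0=\langle\rho(p_H(y^*x))\varphi,\psi\rangle$ on $\mathcal A\otimes\mathcal D(\rho)$ is nonnegative. Then $\operatorname{Ind}\rho$ is the closure of the $*$-representation $a\,[x\otimes\varphi]=[ax\otimes\varphi]$ of $\mathcal A$ on the quotient of $\mathcal A\otimes\mathcal D(\rho)$ by the kernel of the form, a dense subspace of its Hilbert space completion. The system induced by $\rho$ is $(\operatorname{Ind}\rho,E_\rho)$, where $E_\rho(t)$ is the orthogonal projection onto the closed linear span of $\{[a\otimes\varphi]:a\in\mathcal A_t,\ \varphi\in\mathcal D(\rho)\}$. **Theorem.** Let $(\pi,E)$ be a non-degenerate well-behaved system of imprimitivity for $\mathcal A$ over $G/H$. Then there exists an inducible well-behaved $*$-representation $\rho$ of $\mathcal A_H$ such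 that $(\pi,E)$ is unitarily equivalent to the system of imprimitivity induced by $\rho$, and $\rho$ is unique up to unitary equivalence: every inducible well-behaved $*$-representation $\rho'$ of $\mathcal A_H$ such that $(\pi,E)$ is unitarily equivalent to the system induced by $\rho'$ is unitarily equivalent to $\rho$. -/

import Mathlib

universe v w

open scoped TensorProduct ComplexOrder

noncomputable section

namespace Imprim

/-! ### Star-graded algebras -/

/-- A `G`-grading of a `*`-algebra `A`: a vector space decomposition `A = ⨁ g, A_g` with
`A_g A_h ⊆ A_{gh}` and `(A_g)^* ⊆ A_{g⁻¹}`. -/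
structure StarGrading (G : Type*) [Group G] (A : Type*) [Ring A] [StarRing A] [Algebra ℂ A] where
  part : G → Submodule ℂ A
  isInternal : letI := Classical.decEq G; DirectSum.IsInternal part
  mul_mem : ∀ {g h : G} {a b : A}, a ∈ part g → b ∈ part h → a * b ∈ part (g * h)
  star_mem : ∀ {g : G} {a : A}, a ∈ part g → star a ∈ part g⁻¹

namespace StarGrading

variable {G : Type*} [Group G] {A : Type*} [Ring A] [StarRing A] [Algebra ℂ A]

/-- `A_X = ⨁_{g ∈ X} A_g` for a subset `X` of `G`. -/
def sum (𝒢 : StarGrading G A) (X : Set G) : Submodule ℂ A := ⨆ g ∈ X, 𝒢.part g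

open Classical in
/-- The canonical projection `p_X (a) = ∑_{g ∈ X} a_g` where `a = ∑ a_g` with `a_g ∈ A_g`. -/
def proj (𝒢 : StarGrading G A) (X : Set G) : A →ₗ[ℂ] A :=
  DirectSum.coeLinearMap 𝒢.part ∘ₗ
    DFinsupp.filterLinearMap ℂ (fun g => 𝒢.part g) (· ∈ X) ∘ₗ
      (LinearEquiv.ofBijective (DirectSum.coeLinearMap 𝒢.part) 𝒢.isInternal).symm.toLinearMap

theorem part_le_sum (𝒢 : StarGrading G A) {X : Set G} {g : G} (hg : g ∈ X) :
    𝒢.part g ≤ 𝒢.sum X :=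
  le_iSup₂_of_le (f := fun g (_ : g ∈ X) => 𝒢.part g) g hg le_rfl

theorem proj_of_mem (𝒢 : StarGrading G A) (X : Set G) {g : G} {a : A} (ha : a ∈ 𝒢.part g)
    (hg : g ∈ X) : 𝒢.proj X a = a := by
  classical
  have h : (LinearEquiv.ofBijective (DirectSum.coeLinearMap 𝒢.part) 𝒢.isInternal).symm a
      = DFinsupp.single g ⟨a, ha⟩ := by
    rw [LinearEquiv.symm_apply_eq]
    exact (DirectSum.coeLinearMap_lof 𝒢.part g ⟨a, ha⟩).symm
  simp only [proj, LinearMap.comp_apply, LinearEquiv.coe_coe, h]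
  rw [DFinsupp.filterLinearMap_apply, DFinsupp.filter_single_pos _ _ hg]
  exact DirectSum.coeLinearMap_lof 𝒢.part g ⟨a, ha⟩

theorem proj_of_notMem (𝒢 : StarGrading G A) (X : Set G) {g : G} {a : A} (ha : a ∈ 𝒢.part g)
    (hg : g ∉ X) : 𝒢.proj X a = 0 := by
  classical
  have h : (LinearEquiv.ofBijective (DirectSum.coeLinearMap 𝒢.part) 𝒢.isInternal).symm a
      = DFinsupp.single g ⟨a, ha⟩ := by
    rw [LinearEquiv.symm_apply_eq]
    exact (DirectSum.coeLinearMap_lof 𝒢.part g ⟨a, ha⟩).symm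
  simp only [proj, LinearMap.comp_apply, LinearEquiv.coe_coe, h]
  rw [DFinsupp.filterLinearMap_apply, DFinsupp.filter_single_neg _ _ hg]
  exact map_zero _

theorem iSup_part (𝒢 : StarGrading G A) : ⨆ g, 𝒢.part g = ⊤ := by
  classical
  exact DirectSum.IsInternal.submodule_iSup_eq_top 𝒢.isInternal

/-- Induction over homogeneous elements. -/
theorem induction (𝒢 : StarGrading G A) {P : A → Prop} (a : A)
    (hom : ∀ g, ∀ a ∈ 𝒢.part g, P a) (zero : P 0) (add : ∀ a b, P a → P b → P (a + b)) : P a :=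
  Submodule.iSup_induction 𝒢.part (motive := P) (x := a) (by rw [iSup_part]; trivial)
    hom zero add

theorem proj_mem (𝒢 : StarGrading G A) (X : Set G) (a : A) : 𝒢.proj X a ∈ 𝒢.sum X := by
  refine 𝒢.induction (P := fun a => 𝒢.proj X a ∈ 𝒢.sum X) a (fun g a ha => ?_) ?_ ?_
  · by_cases hg : g ∈ X
    · rw [𝒢.proj_of_mem X ha hg]; exact 𝒢.part_le_sum hg ha
    · rw [𝒢.proj_of_notMem X ha hg]; exact zero_mem _
  · simp
  · intro a b ha hb; rw [map_add]; exact add_mem ha hb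

theorem proj_singleton_mem (𝒢 : StarGrading G A) (g : G) (a : A) : 𝒢.proj {g} a ∈ 𝒢.part g := by
  have := 𝒢.proj_mem {g} a
  simpa [sum] using this

theorem one_mem (𝒢 : StarGrading G A) : (1 : A) ∈ 𝒢.part 1 := by
  have key : ∀ g, ∀ a ∈ 𝒢.part g, ∀ x : A,
      𝒢.proj {g} (x * a) = 𝒢.proj {1} x * a := by
    intro g a ha x
    refine 𝒢.induction (P := fun x => 𝒢.proj {g} (x * a) = 𝒢.proj {1} x * a) x
      (fun h x hx => ?_) (by simp) (fun x y hx hy => by rw [add_mul, map_add, hx, hy, map_add, add_mul])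
    by_cases hh : h = 1
    · subst hh
      rw [𝒢.proj_of_mem {1} hx rfl, 𝒢.proj_of_mem {g} (𝒢.mul_mem hx ha) (by simp)]
    · rw [𝒢.proj_of_notMem {1} hx (by simpa using hh),
        𝒢.proj_of_notMem {g} (𝒢.mul_mem hx ha) (by simpa using hh), zero_mul]
  have unit : ∀ a : A, 𝒢.proj {1} 1 * a = a := fun a =>
    𝒢.induction (P := fun a => 𝒢.proj {1} 1 * a = a) a
      (fun g a ha => by rw [← key g a ha, one_mul, 𝒢.proj_of_mem {g} ha rfl]) (by simp)
      (fun a b ha hb => by rw [mul_add, ha, hb])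
  have h := 𝒢.proj_singleton_mem 1 1
  rwa [← mul_one (𝒢.proj {1} 1), unit] at h

theorem proj_star (𝒢 : StarGrading G A) [StarModule ℂ A] (H : Subgroup G) (a : A) :
    𝒢.proj H (star a) = star (𝒢.proj H a) := by
  refine 𝒢.induction (P := fun a => 𝒢.proj H (star a) = star (𝒢.proj H a)) a
    (fun g a ha => ?_) (by simp) (fun a b ha hb => by rw [star_add, map_add, ha, hb, map_add, star_add])
  by_cases hg : g ∈ H
  · rw [𝒢.proj_of_mem _ ha hg, 𝒢.proj_of_mem _ (𝒢.star_mem ha) (H.inv_mem hg)]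
  · rw [𝒢.proj_of_notMem _ ha hg,
      𝒢.proj_of_notMem _ (𝒢.star_mem ha) (fun h => hg (by simpa using H.inv_mem h)), star_zero]

variable [StarModule ℂ A]

/-- The `*`-subalgebra `A_H = ⨁_{h ∈ H} A_h` attached to a subgroup `H` of `G`. -/
def sub (𝒢 : StarGrading G A) (H : Subgroup G) : StarSubalgebra ℂ A where
  carrier := 𝒢.sum (H : Set G)
  zero_mem' := zero_mem _
  add_mem' := add_mem
  one_mem' := 𝒢.part_le_sum H.one_mem 𝒢.one_mem
  algebraMap_mem' r := by
    rw [Algebra.algebraMap_eq_smul_one]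
    exact Submodule.smul_mem _ r (𝒢.part_le_sum H.one_mem 𝒢.one_mem)
  mul_mem' {a b} ha hb := by
    have hb' : b ∈ 𝒢.sum (H : Set G) := hb
    have ha' : a ∈ 𝒢.sum (H : Set G) := ha
    show a * b ∈ 𝒢.sum (H : Set G)
    have : 𝒢.sum (H : Set G) * 𝒢.sum (H : Set G) ≤ 𝒢.sum (H : Set G) := by
      simp only [sum, Submodule.iSup_mul, Submodule.mul_iSup, iSup_le_iff]
      intro g hg h hh
      rw [Submodule.mul_le]
      intro x hx y hy
      exact 𝒢.part_le_sum (X := (H : Set G)) (H.mul_mem hh hg) (𝒢.mul_mem hx hy)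
    exact this (Submodule.mul_mem_mul ha' hb')
  star_mem' {a} ha := by
    have ha' : a ∈ 𝒢.sum (H : Set G) := ha
    show star a ∈ 𝒢.sum (H : Set G)
    have h : 𝒢.proj H a = a := by
      have hle : 𝒢.sum (H : Set G) ≤ LinearMap.eqLocus (𝒢.proj H) LinearMap.id :=
        iSup₂_le fun g hg a ha => 𝒢.proj_of_mem _ ha hg
      exact hle ha'
    rw [← h, ← 𝒢.proj_star]
    exact 𝒢.proj_mem _ _

/-- The `*`-subalgebra `B = A_e` attached to the unit `e` of `G`. -/
def base (𝒢 : StarGrading G A) : StarSubalgebra ℂ A where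
  carrier := 𝒢.part 1
  zero_mem' := zero_mem _
  add_mem' := add_mem
  one_mem' := 𝒢.one_mem
  algebraMap_mem' r := by
    rw [Algebra.algebraMap_eq_smul_one]
    exact Submodule.smul_mem _ r 𝒢.one_mem
  mul_mem' {a b} ha hb := by
    have := 𝒢.mul_mem ha hb
    rwa [one_mul] at this
  star_mem' {a} ha := by
    have := 𝒢.star_mem ha
    rwa [inv_one] at this

theorem base_le_sub (𝒢 : StarGrading G A) (H : Subgroup G) : 𝒢.base ≤ 𝒢.sub H :=
  fun _ ha => 𝒢.part_le_sum H.one_mem ha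

/-- The canonical conditional expectation `p_H : A → A_H`. -/
def condExp (𝒢 : StarGrading G A) (H : Subgroup G) : A →ₗ[ℂ] 𝒢.sub H where
  toFun a := ⟨𝒢.proj H a, 𝒢.proj_mem H a⟩
  map_add' a b := Subtype.ext (map_add _ a b)
  map_smul' r a := Subtype.ext (map_smul _ r a)

theorem condExp_star (𝒢 : StarGrading G A) (H : Subgroup G) (a : A) :
    𝒢.condExp H (star a) = star (𝒢.condExp H a) :=
  Subtype.ext (𝒢.proj_star H a)

/-- `B = A_e` is countably generated as a `*`-algebra. -/
def BaseCountablyGenerated (𝒢 : StarGrading G A) : Prop :=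
  ∃ S : Set A, S.Countable ∧ StarAlgebra.adjoin ℂ S = 𝒢.base

/-! ### The characters of `B` that are nonnegative on `∑ A² ∩ B`, and the partial action -/

/-- The space of characters `χ` of `B = A_e` that are nonnegative on `∑ A² ∩ B`. As `B` is
unital, a nontrivial `*`-homomorphism `B → ℂ` is the same as a unital one. -/
structure PosChar (𝒢 : StarGrading G A) where
  toHom : 𝒢.base →⋆ₐ[ℂ] ℂ
  nonneg : ∀ b : 𝒢.base,
    (b : A) ∈ AddSubmonoid.closure (Set.range fun a : A => star a * a) → 0 ≤ toHom b

/-- The weakest topology for which all functions `f_b : χ ↦ χ b` are continuous. -/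
instance (𝒢 : StarGrading G A) : TopologicalSpace 𝒢.PosChar :=
  TopologicalSpace.induced (fun χ (b : 𝒢.base) => χ.toHom b) inferInstance

instance (𝒢 : StarGrading G A) : MeasurableSpace 𝒢.PosChar := borel _

/-- The element `a^* b a` of `B`, for `a ∈ A_g` and `b ∈ B`. -/
def sandwich (𝒢 : StarGrading G A) {g : G} (a : 𝒢.part g) (b : 𝒢.base) : 𝒢.base :=
  ⟨star (a : A) * b * a, by
    have hb : (b : A) ∈ 𝒢.part 1 := b.2
    have := 𝒢.mul_mem (𝒢.mul_mem (𝒢.star_mem a.2) hb) a.2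
    rw [mul_one, inv_mul_cancel] at this
    exact this⟩

/-- `Δ^g`: the set of all characters `χ^g`, where `χ ∈ Δ` is such that `χ^g` is defined, that is,
`χ(a^* a) ≠ 0` for some `a ∈ A_g`; then `χ^g (b) = χ(a^* b a) / χ(a^* a)`. -/
def translate (𝒢 : StarGrading G A) (g : G) (Δ : Set 𝒢.PosChar) : Set 𝒢.PosChar :=
  {ψ | ∃ χ ∈ Δ, ∃ a : 𝒢.part g, χ.toHom (𝒢.sandwich a 1) ≠ 0 ∧
    ∀ b, ψ.toHom b = χ.toHom (𝒢.sandwich a b) / χ.toHom (𝒢.sandwich a 1)}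

end StarGrading

/-! ### `*`-representations by unbounded operators -/

/-- A `*`-representation of a `*`-algebra `A` on a dense linear subspace of `K`. -/
structure StarRep (A : Type*) [Ring A] [StarRing A] [Algebra ℂ A]
    (K : Type*) [NormedAddCommGroup K] [InnerProductSpace ℂ K] where
  domain : Submodule ℂ K
  dense : Dense (domain : Set K)
  toHom : A →ₙₐ[ℂ] Module.End ℂ domain
  inner_toHom : ∀ (a : A) (φ ψ : domain),
    inner ℂ (toHom a φ : K) (ψ : K) = inner ℂ (φ : K) (toHom (star a) ψ : K)

namespace StarRep

variable {A : Type*} [Ring A] [StarRing A] [Algebra ℂ A]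
  {K : Type*} [NormedAddCommGroup K] [InnerProductSpace ℂ K]
  {K' : Type*} [NormedAddCommGroup K'] [InnerProductSpace ℂ K']

/-- The operator `π(a)` with domain `D(π)`. -/
def op (π : StarRep A K) (a : A) : K →ₗ.[ℂ] K where
  domain := π.domain
  toFun := π.domain.subtype ∘ₗ π.toHom a

/-- The map `φ ↦ (φ, (π(a)φ)_a)`. The locally convex topology which it induces on `D(π)` is the
one defined by the norms `‖φ‖ + ‖π(a)φ‖`, `a ∈ A`. -/
def graphMap (π : StarRep A K) (φ : π.domain) : K × (A → K) :=
  ((φ : K), fun a => (π.toHom a φ : K))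

/-- The uniform structure of the graph topology on `D(π)`. -/
@[reducible] def graphUniformity (π : StarRep A K) : UniformSpace π.domain :=
  UniformSpace.comap π.graphMap inferInstance

/-- `π` is closed: `D(π)` is complete in the graph topology. -/
def IsClosedRep (π : StarRep A K) : Prop :=
  @CompleteSpace π.domain π.graphUniformity

/-- `S` is dense in `T` in the graph topology of `π`. -/
def GraphDenseIn (π : StarRep A K) (S T : Set π.domain) : Prop :=
  S ⊆ T ∧ T ⊆ @closure π.domain π.graphUniformity.toTopologicalSpace S

/-- The pull-back of a `*`-representation along a unital `*`-homomorphism (for an inclusion of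
`*`-subalgebras this is the restriction). -/
def comp (π : StarRep A K) {C : Type*} [Ring C] [StarRing C] [Algebra ℂ C] (j : C →⋆ₐ[ℂ] A) :
    StarRep C K where
  domain := π.domain
  dense := π.dense
  toHom := π.toHom.comp (j.toAlgHom : C →ₙₐ[ℂ] A)
  inner_toHom c φ ψ := by
    have := π.inner_toHom (j c) φ ψ
    rw [← map_star] at this
    exact this

/-- An integrable representation (of a commutative `*`-algebra): a closed `*`-representation with
`closure of π(b^*) = π(b)^*` for all `b`. -/
def IsIntegrable [CompleteSpace K] (π : StarRep A K) : Prop :=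
  π.IsClosedRep ∧ ∀ b : A, (π.op (star b)).closure = (π.op b).adjoint

/-- Unitary equivalence of `*`-representations. -/
def Equivalent (π : StarRep A K) (π' : StarRep A K') : Prop :=
  ∃ U : π.domain ≃ₗᵢ[ℂ] π'.domain, ∀ (a : A) (φ : π.domain), U (π.toHom a φ) = π'.toHom a (U φ)

/-- The inclusion of operators `Q π(a) ⊆ π(a) P` for bounded operators `P`, `Q`. -/
def Intertwines (π : StarRep A K) (a : A) (P Q : K →L[ℂ] K) : Prop :=
  ∀ φ : π.domain, ∃ h : P φ ∈ π.domain, (π.toHom a ⟨P φ, h⟩ : K) = Q (π.toHom a φ)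

end StarRep

/-! ### Spectral measures -/

/-- A spectral measure on `X` with values in the orthogonal projections of `K`; it is evaluated at
measurable sets only. -/
structure SpectralMeasure (X : Type*) [MeasurableSpace X]
    (K : Type*) [NormedAddCommGroup K] [InnerProductSpace ℂ K] [CompleteSpace K] where
  proj : Set X → (K →L[ℂ] K)
  isStarProjection : ∀ s, MeasurableSet s → IsStarProjection (proj s)
  univ : proj Set.univ = 1
  hasSum : ∀ s : ℕ → Set X, (∀ n, MeasurableSet (s n)) → Pairwise (Function.onFun Disjoint s) →
    ∀ φ : K, HasSum (fun n => proj (s n) φ) (proj (⋃ n, s n) φ)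

namespace SpectralMeasure

variable {X : Type*} [MeasurableSpace X]
  {K : Type*} [NormedAddCommGroup K] [InnerProductSpace ℂ K] [CompleteSpace K]

theorem proj_empty (E : SpectralMeasure X K) (φ : K) : E.proj ∅ φ = 0 := by
  have h : Summable fun _ : ℕ => E.proj ∅ φ := (E.hasSum (fun _ => ∅)
    (fun _ => MeasurableSet.empty) (fun _ _ _ => disjoint_bot_left) φ).summable
  exact (summable_const_iff _).1 h

theorem re_inner_nonneg (E : SpectralMeasure X K) {s : Set X} (hs : MeasurableSet s) (φ : K) :
    0 ≤ (inner ℂ φ (E.proj s φ)).re := by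
  have hp := E.isStarProjection s hs
  have h1 : E.proj s (E.proj s φ) = E.proj s φ := by
    have := congrArg (fun T : K →L[ℂ] K => T φ) hp.isIdempotentElem.eq
    simpa using this
  have h2 : inner ℂ φ (E.proj s φ) = inner ℂ (E.proj s φ) (E.proj s φ) := by
    conv_lhs => rw [← h1]
    rw [← ContinuousLinearMap.adjoint_inner_left, ← ContinuousLinearMap.star_eq_adjoint,
      hp.isSelfAdjoint.star_eq]
  rw [h2]
  exact inner_self_nonneg (𝕜 := ℂ)

/-- The measure `Δ ↦ ⟨E(Δ) φ, φ⟩`. -/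
def diag (E : SpectralMeasure X K) (φ : K) : MeasureTheory.Measure X :=
  MeasureTheory.Measure.ofMeasurable (fun s _ => ENNReal.ofReal (inner ℂ φ (E.proj s φ)).re)
    (by simp [E.proj_empty]) (by
      intro s hs hd
      have h := (E.hasSum s hs hd φ).mapL (Complex.reCLM.comp ((innerSL ℂ φ).restrictScalars ℝ))
      have h' : HasSum (fun n => (inner ℂ φ (E.proj (s n) φ)).re)
        (inner ℂ φ (E.proj (⋃ n, s n) φ)).re := h
      rw [← h'.tsum_eq]
      exact ENNReal.ofReal_tsum_of_nonneg (fun n => E.re_inner_nonneg (hs n) φ) h'.summable)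

/-- `T = ∫ f dE`: the domain of `T` is `{φ : ∫ |f|² d⟨E(·)φ,φ⟩ < ∞}` and
`⟨Tφ,φ⟩ = ∫ f d⟨E(·)φ,φ⟩` for `φ` in the domain of `T` (which, by polarization, determines `T`). -/
def IsIntegral (E : SpectralMeasure X K) (f : X → ℂ) (T : K →ₗ.[ℂ] K) : Prop :=
  (∀ φ : K, φ ∈ T.domain ↔ ∫⁻ x, ENNReal.ofReal (‖f x‖ ^ 2) ∂(E.diag φ) < ⊤) ∧
    ∀ φ : T.domain, inner ℂ (φ : K) (T φ) = ∫ x, f x ∂(E.diag φ)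

end SpectralMeasure

/-! ### Well-behaved representations -/

section WellBehaved

variable {G : Type*} [Group G] {A : Type*} [Ring A] [StarRing A] [Algebra ℂ A] [StarModule ℂ A]
  {K : Type*} [NormedAddCommGroup K] [InnerProductSpace ℂ K] [CompleteSpace K]

/-- The representation `σ` of `B` is integrable and `closure of σ(b) = ∫ f_b dE` for all `b`. -/
def IsGivenBy (𝒢 : StarGrading G A) (σ : StarRep 𝒢.base K) (E : SpectralMeasure 𝒢.PosChar K) :
    Prop :=
  σ.IsIntegrable ∧ ∀ b : 𝒢.base, E.IsIntegral (fun χ => χ.toHom b) (σ.op b).closure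

/-- The representation `π` of `A` is well-behaved with associated spectral measure `E`. -/
def WellBehavedWith (𝒢 : StarGrading G A) (π : StarRep A K) (E : SpectralMeasure 𝒢.PosChar K) :
    Prop :=
  IsGivenBy 𝒢 (π.comp 𝒢.base.subtype) E ∧
    ∀ (g : G), ∀ a ∈ 𝒢.part g, ∀ Δ : Set 𝒢.PosChar, MeasurableSet Δ →
      π.Intertwines a (E.proj Δ) (E.proj (𝒢.translate g Δ))

/-- The representation `ρ` of `A_H` is well-behaved. -/
def WellBehavedSub (𝒢 : StarGrading G A) (H : Subgroup G) (ρ : StarRep (𝒢.sub H) K) : Prop :=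
  ∃ E : SpectralMeasure 𝒢.PosChar K,
    IsGivenBy 𝒢 (ρ.comp (StarSubalgebra.inclusion (𝒢.base_le_sub H))) E ∧
    ∀ h ∈ H, ∀ a : 𝒢.sub H, (a : A) ∈ 𝒢.part h → ∀ Δ : Set 𝒢.PosChar, MeasurableSet Δ →
      ρ.Intertwines a (E.proj Δ) (E.proj (𝒢.translate h Δ))

end WellBehaved

/-! ### Systems of imprimitivity -/

section Systems

variable {G : Type*} [Group G] {A : Type*} [Ring A] [StarRing A] [Algebra ℂ A]
  {K : Type*} [NormedAddCommGroup K] [InnerProductSpace ℂ K] [CompleteSpace K]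
  {K' : Type*} [NormedAddCommGroup K'] [InnerProductSpace ℂ K']

/-- `(π, E)` is a system of imprimitivity for the graded algebra over `G/H`. -/
structure IsSystem (𝒢 : StarGrading G A) {H : Subgroup G} (π : StarRep A K)
    (E : G ⧸ H → (K →L[ℂ] K)) : Prop where
  isStarProjection : ∀ t, IsStarProjection (E t)
  mul_eq_zero : ∀ s t, s ≠ t → E s * E t = 0
  hasSum : ∀ φ : K, HasSum (fun t => E t φ) φ
  intertwines : ∀ (g : G) (t : G ⧸ H), ∀ a ∈ 𝒢.part g, π.Intertwines a (E t) (E (g • t))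


/-- The subspace `D_t(π) = Ran E(t) ∩ D(π)`. -/
def component (π : StarRep A K) {H : Subgroup G} (E : G ⧸ H → (K →L[ℂ] K)) (t : G ⧸ H) :
    Submodule ℂ π.domain :=
  (LinearMap.range (E t).toLinearMap).comap π.domain.subtype

/-- Non-degeneracy: for all `t` the linear span of `π(A_t) D_H(π)` is dense in `D_t(π)` with
respect to the graph topology, where `A_t = ⨁_{g ∈ t} A_g`. -/
def IsNondegenerate (𝒢 : StarGrading G A) {H : Subgroup G} (π : StarRep A K)
    (E : G ⧸ H → (K →L[ℂ] K)) : Prop :=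
  ∀ t : G ⧸ H, π.GraphDenseIn
    (Submodule.span ℂ {ξ : π.domain | ∃ a ∈ 𝒢.sum {g : G | (g : G ⧸ H) = t},
      ∃ φ ∈ component π E ((1 : G) : G ⧸ H), ξ = π.toHom a φ})
    (component π E t)

/-- A system `(π, E)` is well-behaved: `π` is well-behaved, with a spectral measure `E_π` whose
projections commute with all `E(t)`. -/
def IsWellBehavedSystem [StarModule ℂ A] (𝒢 : StarGrading G A) {H : Subgroup G} (π : StarRep A K)
    (E : G ⧸ H → (K →L[ℂ] K)) : Prop :=
  ∃ F : SpectralMeasure 𝒢.PosChar K, WellBehavedWith 𝒢 π F ∧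
    ∀ (t : G ⧸ H) (Δ : Set 𝒢.PosChar), MeasurableSet Δ → E t * F.proj Δ = F.proj Δ * E t

/-- Unitary equivalence of pairs `(π, E)`, `(π', E')`. -/
def SystemEquivalent {H : Subgroup G} (π : StarRep A K) (E : G ⧸ H → (K →L[ℂ] K))
    (π' : StarRep A K') (E' : G ⧸ H → (K' →L[ℂ] K')) : Prop :=
  ∃ U : K ≃ₗᵢ[ℂ] K',
    (∀ φ : K, φ ∈ π.domain ↔ U φ ∈ π'.domain) ∧
    (∀ (a : A) (φ : π.domain) (h : U φ ∈ π'.domain),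
      U (π.toHom a φ) = (π'.toHom a ⟨U φ, h⟩ : K')) ∧
    ∀ (t : G ⧸ H) (φ : K), U (E t φ) = E' t (U φ)

end Systems

/-! ### The closure of a `*`-representation given on a core -/

section Core

variable {A : Type*} [Ring A] [Algebra ℂ A]
  {K : Type*} [NormedAddCommGroup K] [InnerProductSpace ℂ K]
  {V : Type*} [AddCommGroup V] [Module ℂ V]

/-- The closure in `K × K^A` of `{(ι v, (ι (a v))_a) : v ∈ V}`. -/
def coreGraph (ι : V →ₗ[ℂ] K) (α : A →ₙₐ[ℂ] Module.End ℂ V) : Submodule ℂ (K × (A → K)) :=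
  (LinearMap.range (ι.prod (LinearMap.pi fun a => ι ∘ₗ α a))).topologicalClosure

/-- A closed property that holds on the core holds on the closure. -/
theorem coreGraph_induction {ι : V →ₗ[ℂ] K} {α : A →ₙₐ[ℂ] Module.End ℂ V}
    {P : K × (A → K) → Prop} (hP : IsClosed {p | P p})
    (h : ∀ v, P (ι v, fun a => ι (α a v))) {p : K × (A → K)} (hp : p ∈ coreGraph ι α) : P p := by
  have hsub : closure ((LinearMap.range (ι.prod (LinearMap.pi fun a => ι ∘ₗ α a)) :
      Submodule ℂ (K × (A → K))) : Set (K × (A → K))) ⊆ {p | P p} := by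
    refine closure_minimal ?_ hP
    rintro _ ⟨v, rfl⟩
    exact h v
  exact hsub hp

theorem coreGraph_core (ι : V →ₗ[ℂ] K) (α : A →ₙₐ[ℂ] Module.End ℂ V) (v : V) :
    (ι v, fun a => ι (α a v)) ∈ coreGraph ι α :=
  Submodule.le_topologicalClosure _ ⟨v, rfl⟩

variable {ι : V →ₗ[ℂ] K} {α : A →ₙₐ[ℂ] Module.End ℂ V}

theorem coreGraph_inner [StarRing A]
    (hα : ∀ a v w, inner ℂ (ι (α a v)) (ι w) = inner ℂ (ι v) (ι (α (star a) w)))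
    {p q : K × (A → K)} (hp : p ∈ coreGraph ι α) (hq : q ∈ coreGraph ι α) (a : A) :
    inner ℂ (p.2 a) q.1 = inner ℂ p.1 (q.2 (star a)) := by
  refine coreGraph_induction (P := fun p => inner ℂ (p.2 a) q.1 = inner ℂ p.1 (q.2 (star a)))
    (isClosed_eq (by fun_prop) (by fun_prop)) (fun v => ?_) hp
  refine coreGraph_induction
    (P := fun q => inner ℂ (ι (α a v)) q.1 = inner ℂ (ι v) (q.2 (star a)))
    (isClosed_eq (by fun_prop) (by fun_prop)) (fun w => hα a v w) hq

theorem coreGraph_unique [StarRing A] (hι : DenseRange ι)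
    (hα : ∀ a v w, inner ℂ (ι (α a v)) (ι w) = inner ℂ (ι v) (ι (α (star a) w)))
    {φ : K} {Φ Ψ : A → K} (hΦ : (φ, Φ) ∈ coreGraph ι α) (hΨ : (φ, Ψ) ∈ coreGraph ι α) :
    Φ = Ψ := by
  funext a
  refine hι.eq_of_inner_left (𝕜 := ℂ) ?_
  intro w
  exact (coreGraph_inner hα hΦ (coreGraph_core ι α w) a).trans
    (coreGraph_inner hα hΨ (coreGraph_core ι α w) a).symm

theorem coreGraph_act {φ : K} {Φ : A → K} (hΦ : (φ, Φ) ∈ coreGraph ι α) (a : A) :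
    (Φ a, fun b => Φ (b * a)) ∈ coreGraph ι α := by
  refine coreGraph_induction (P := fun p => (p.2 a, fun b => p.2 (b * a)) ∈ coreGraph ι α)
    ?_ (fun v => ?_) hΦ
  · have hc : IsClosed (coreGraph ι α : Set (K × (A → K))) :=
      Submodule.isClosed_topologicalClosure _
    exact hc.preimage (by fun_prop)
  · have := coreGraph_core ι α (α a v)
    simpa [map_mul] using this

/-- Let `ι : V → K` be linear with dense range, and let `A` act on `V` such that
`ι v ↦ ι (a v)` is a (well-defined) `*`-representation of `A` on `ι(V)`. This is the closure of
that `*`-representation. -/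
def closureOfCore [StarRing A] (ι : V →ₗ[ℂ] K) (α : A →ₙₐ[ℂ] Module.End ℂ V) (hι : DenseRange ι)
    (hα : ∀ a v w, inner ℂ (ι (α a v)) (ι w) = inner ℂ (ι v) (ι (α (star a) w))) :
    StarRep A K := by
  let D : Submodule ℂ K := (coreGraph ι α).map (LinearMap.fst ℂ K (A → K))
  have hD : ∀ φ : D, ∃ Φ : A → K, ((φ : K), Φ) ∈ coreGraph ι α := by
    rintro ⟨_, ⟨⟨φ, Φ⟩, h, rfl⟩⟩
    exact ⟨Φ, h⟩
  let ext : D → A → K := fun φ => (hD φ).choose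
  have hext : ∀ φ : D, ((φ : K), ext φ) ∈ coreGraph ι α := fun φ => (hD φ).choose_spec
  have huniq : ∀ (φ : D) (Φ : A → K), ((φ : K), Φ) ∈ coreGraph ι α → ext φ = Φ :=
    fun φ Φ h => coreGraph_unique hι hα (hext φ) h
  have hmem : ∀ (φ : D) (a : A), ext φ a ∈ D := fun φ a => ⟨_, coreGraph_act (hext φ) a, rfl⟩
  exact
  { domain := D
    dense := hι.mono (by rintro _ ⟨v, rfl⟩; exact ⟨_, coreGraph_core ι α v, rfl⟩)
    toHom :=
    { toFun := fun a =>
      { toFun := fun φ => ⟨ext φ a, hmem φ a⟩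
        map_add' := fun φ ψ => Subtype.ext
          (congrFun (huniq (φ + ψ) (ext φ + ext ψ) (add_mem (hext φ) (hext ψ))) a)
        map_smul' := fun c φ => Subtype.ext
          (congrFun (huniq (c • φ) (c • ext φ) (Submodule.smul_mem _ c (hext φ))) a) }
      map_smul' := fun c a => by
        ext φ
        exact coreGraph_induction (P := fun p => p.2 (c • a) = c • p.2 a)
          (isClosed_eq (by fun_prop) (by fun_prop)) (fun v => by simp) (hext φ)
      map_zero' := by
        ext φ
        exact coreGraph_induction (P := fun p => p.2 0 = 0)
          (isClosed_eq (by fun_prop) (by fun_prop)) (fun v => by simp) (hext φ)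
      map_add' := fun a b => by
        ext φ
        exact coreGraph_induction (P := fun p => p.2 (a + b) = p.2 a + p.2 b)
          (isClosed_eq (by fun_prop) (by fun_prop)) (fun v => by simp) (hext φ)
      map_mul' := fun a b => by
        ext φ
        exact (congrFun (huniq ⟨ext φ b, hmem φ b⟩ _ (coreGraph_act (hext φ) b)) a).symm }
    inner_toHom := fun a φ ψ => coreGraph_inner hα (hext φ) (hext ψ) a }

end Core

/-! ### Induced representations -/

section Induced

variable {G : Type*} [Group G] {A : Type*} [Ring A] [StarRing A] [Algebra ℂ A] [StarModule ℂ A]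
  {K : Type*} [NormedAddCommGroup K] [InnerProductSpace ℂ K]

/-- The sesquilinear form `⟨·,·⟩₀` on `A ⊗ D(ρ)`, determined by
`⟨y ⊗ ψ, x ⊗ φ⟩₀ = ⟨ρ(p_H(x^* y)) ψ, φ⟩`. Following Mathlib's convention for inner products, the
argument that is conjugate linear is written first. -/
def indForm (𝒢 : StarGrading G A) (H : Subgroup G) (ρ : StarRep (𝒢.sub H) K) :
    (A ⊗[ℂ] ρ.domain) →ₗ⋆[ℂ] (A ⊗[ℂ] ρ.domain) →ₗ[ℂ] ℂ :=
  TensorProduct.lift <| LinearMap.mk₂'ₛₗ (starRingEnd ℂ) (starRingEnd ℂ)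
    (fun (x : A) (φ : ρ.domain) => TensorProduct.lift <| LinearMap.mk₂ ℂ
      (fun (y : A) (ψ : ρ.domain) =>
        inner ℂ (φ : K) (ρ.toHom (𝒢.condExp H (star x * y)) ψ : K))
      (fun y y' ψ => by simp [mul_add])
      (fun c y ψ => by simp)
      (fun y ψ ψ' => by simp)
      (fun c y ψ => by simp))
    (fun x x' φ => TensorProduct.ext' fun y ψ => by simp [add_mul])
    (fun c x φ => TensorProduct.ext' fun y ψ => by simp)
    (fun x φ φ' => TensorProduct.ext' fun y ψ => by simp)
    (fun c x φ => TensorProduct.ext' fun y ψ => by simp [mul_comm])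

@[simp] theorem indForm_tmul (𝒢 : StarGrading G A) (H : Subgroup G) (ρ : StarRep (𝒢.sub H) K)
    (x y : A) (φ ψ : ρ.domain) :
    indForm 𝒢 H ρ (x ⊗ₜ φ) (y ⊗ₜ ψ) =
      inner ℂ (φ : K) (ρ.toHom (𝒢.condExp H (star x * y)) ψ : K) := rfl

theorem indForm_conj (𝒢 : StarGrading G A) (H : Subgroup G) (ρ : StarRep (𝒢.sub H) K)
    (ξ η : A ⊗[ℂ] ρ.domain) :
    starRingEnd ℂ (indForm 𝒢 H ρ η ξ) = indForm 𝒢 H ρ ξ η := by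
  induction ξ with
  | zero => simp
  | add ξ ξ' h h' => simp [h, h']
  | tmul x φ =>
    induction η with
    | zero => simp
    | add η η' h h' => simp [h, h']
    | tmul y ψ =>
      rw [indForm_tmul, indForm_tmul, inner_conj_symm, ρ.inner_toHom, ← 𝒢.condExp_star]
      simp

/-- `ρ` is inducible: the form `⟨·,·⟩₀` (which is Hermitian) is nonnegative. -/
def Inducible (𝒢 : StarGrading G A) (H : Subgroup G) (ρ : StarRep (𝒢.sub H) K) : Prop :=
  ∀ ξ, 0 ≤ (indForm 𝒢 H ρ ξ ξ).re

variable {𝒢 : StarGrading G A} {H : Subgroup G} {ρ : StarRep (𝒢.sub H) K}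

/-- The space `A ⊗ D(ρ)`, with the semi-inner product `⟨·,·⟩₀`. -/
def PreInd (_ : Inducible 𝒢 H ρ) : Type _ := A ⊗[ℂ] ρ.domain

instance (hρ : Inducible 𝒢 H ρ) : AddCommGroup (PreInd hρ) :=
  inferInstanceAs (AddCommGroup (A ⊗[ℂ] ρ.domain))

instance (hρ : Inducible 𝒢 H ρ) : Module ℂ (PreInd hρ) :=
  inferInstanceAs (Module ℂ (A ⊗[ℂ] ρ.domain))

/-- The semi-inner product `⟨·,·⟩₀`. -/
@[reducible] def preIndCore (hρ : Inducible 𝒢 H ρ) : PreInnerProductSpace.Core ℂ (PreInd hρ) where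
  inner ξ η := indForm 𝒢 H ρ ξ η
  conj_inner_symm ξ η := indForm_conj 𝒢 H ρ ξ η
  re_inner_nonneg ξ := hρ ξ
  add_left ξ η ζ := LinearMap.congr_fun (map_add (indForm 𝒢 H ρ) ξ η) ζ
  smul_left ξ η c := LinearMap.congr_fun (map_smulₛₗ (indForm 𝒢 H ρ) c ξ) η

instance (hρ : Inducible 𝒢 H ρ) : SeminormedAddCommGroup (PreInd hρ) :=
  @InnerProductSpace.Core.toSeminormedAddCommGroup ℂ _ _ _ _ (preIndCore hρ)

instance (hρ : Inducible 𝒢 H ρ) : InnerProductSpace ℂ (PreInd hρ) :=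
  InnerProductSpace.ofCore (preIndCore hρ)

/-- The Hilbert space of the induced representation: the completion of the quotient of `A ⊗ D(ρ)`
by the kernel of `⟨·,·⟩₀`. (This kernel contains all vectors `x b ⊗ φ - x ⊗ ρ(b) φ`, `b ∈ A_H`, so
that the quotient of `A ⊗_{A_H} D(ρ)` by the kernel of the form is the same space.) -/
abbrev IndSpace (hρ : Inducible 𝒢 H ρ) : Type _ := UniformSpace.Completion (PreInd hρ)

/-- The map `ξ ↦ [ξ]` of `A ⊗ D(ρ)` into the Hilbert space of the induced representation. -/
def indClass (hρ : Inducible 𝒢 H ρ) : (A ⊗[ℂ] ρ.domain) →ₗ[ℂ] IndSpace hρ :=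
  (UniformSpace.Completion.toComplL (𝕜 := ℂ) (E := PreInd hρ)).toLinearMap

theorem inner_indClass (hρ : Inducible 𝒢 H ρ) (ξ η : A ⊗[ℂ] ρ.domain) :
    inner ℂ (indClass hρ ξ) (indClass hρ η) = indForm 𝒢 H ρ ξ η :=
  UniformSpace.Completion.inner_coe (𝕜 := ℂ) (E := PreInd hρ) ξ η

theorem denseRange_indClass (hρ : Inducible 𝒢 H ρ) : DenseRange (indClass hρ) :=
  UniformSpace.Completion.denseRange_coe (α := PreInd hρ)

/-- The action of `A` on `A ⊗ D(ρ)`, `a (x ⊗ φ) = a x ⊗ φ`. -/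
def indAction (ρ : StarRep (𝒢.sub H) K) : A →ₙₐ[ℂ] Module.End ℂ (A ⊗[ℂ] ρ.domain) where
  toFun a := LinearMap.rTensor ρ.domain (LinearMap.mulLeft ℂ a)
  map_smul' c a := TensorProduct.ext' fun x φ => by simp [TensorProduct.smul_tmul']
  map_zero' := TensorProduct.ext' fun x φ => by simp
  map_add' a b := TensorProduct.ext' fun x φ => by simp [add_mul, TensorProduct.add_tmul]
  map_mul' a b := TensorProduct.ext' fun x φ => by simp

theorem indForm_action (ρ : StarRep (𝒢.sub H) K) (a : A) (ξ η : A ⊗[ℂ] ρ.domain) :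
    indForm 𝒢 H ρ (indAction ρ a ξ) η = indForm 𝒢 H ρ ξ (indAction ρ (star a) η) := by
  induction ξ with
  | zero => simp
  | add ξ ξ' h h' => simp [h, h']
  | tmul x φ =>
    induction η with
    | zero => simp
    | add η η' h h' => rw [map_add, h, h', map_add, map_add]
    | tmul y ψ =>
      have h1 : indAction ρ a (x ⊗ₜ φ) = (a * x) ⊗ₜ φ := rfl
      have h2 : indAction ρ (star a) (y ⊗ₜ ψ) = (star a * y) ⊗ₜ ψ := rfl
      rw [h1, h2, indForm_tmul, indForm_tmul, star_mul, mul_assoc]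

/-- The induced representation `Ind ρ`: the closure of the `*`-representation
`[x ⊗ φ] ↦ [a x ⊗ φ]` on the vectors `[ξ]`, `ξ ∈ A ⊗ D(ρ)`. -/
def ind (hρ : Inducible 𝒢 H ρ) : StarRep A (IndSpace hρ) :=
  closureOfCore (indClass hρ) (indAction ρ) (denseRange_indClass hρ) fun a ξ η => by
    rw [inner_indClass, inner_indClass, indForm_action]

/-- The projections of the system of imprimitivity induced by `ρ`: `E(t)` is the orthogonal
projection onto the closed linear span of the vectors `[a ⊗ φ]` with `a ∈ A_t`, `φ ∈ D(ρ)`. -/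
def indProj (hρ : Inducible 𝒢 H ρ) (t : G ⧸ H) : IndSpace hρ →L[ℂ] IndSpace hρ :=
  (Submodule.span ℂ {ξ : IndSpace hρ | ∃ a ∈ 𝒢.sum {g : G | (g : G ⧸ H) = t}, ∃ φ : ρ.domain,
    ξ = indClass hρ (a ⊗ₜ φ)}).topologicalClosure.starProjection

end Induced

end Imprim

end

open Imprim

/-!
Write `t₀ = H` for the base point of `G/H` and `D_H(π) = Ran E(t₀) ∩ D(π)`.

*Existence.* The operators `π(b)`, `b ∈ A_H`, commute with the projection `E(t₀)`, so `ρ`, the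
restriction of `π` to `A_H` acting on `D_H(π)`, is a `*`-representation on `M = Ran E(t₀)`
(`StarRep.reduce`). Integrability passes to `ρ` because closures and adjoints of the operators may be
computed inside the reducing subspace `M`, and the spectral measure of `π` commutes with `E(t₀)`, so
its part on `M` represents `ρ` (`WellBehavedWith.wellBehavedSub_reduce`). For `φ, ψ ∈ D_H(π)` the
vector `π(a_g)ψ` lies in `Ran E(gH)`, hence is orthogonal to `φ` unless `g ∈ H`; this gives
`⟨π(x)φ, π(y)ψ⟩ = ⟨x ⊗ φ, y ⊗ ψ⟩₀`, that is, the form is nonnegative and `[x ⊗ φ] ↦ π(x)φ` is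
isometric (`inner_actionMap`). Non-degeneracy, together with `∑ E(t) = I` in the graph topology, says
that the vectors `π(x)φ` span a graph-dense subspace of `D(π)`, and as `π` is closed the isometry is a
unitary equivalence of `π` with `Ind ρ` (`systemEquivalent_reduce`).

*Uniqueness.* It suffices to recover a well-behaved `ρ'` from the system that it induces. Since
`ρ'(1) = I`, the map `φ ↦ [1 ⊗ φ]` extends to an isometry `J` of the Hilbert space of `ρ'`, and it
intertwines `ρ'` with the restriction of `Ind ρ'` to `A_H`. Its adjoint is `[x ⊗ φ] ↦ ρ'(p_H(x))φ`,
which by closedness of `ρ'` maps the domain of `Ind ρ'` into that of `ρ'`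
(`mem_domain_of_apply_indClass`), and `J J^*` is the identity on the range of `E_{ρ'}(t₀)`
(`apply_adjoint_of_indProj_eq_self`). So `J` identifies `ρ'` with the part of `Ind ρ'` on the range of
`E_{ρ'}(t₀)`, which under the given equivalence of systems is `ρ`
(`equivalent_reduce_of_systemEquivalent`).
-/

namespace Imprim

/-! ### Closedness, closures, adjoints, and reducing subspaces -/

namespace StarRep

variable {A : Type*} [Ring A] [StarRing A] [Algebra ℂ A]
  {K : Type*} [NormedAddCommGroup K] [InnerProductSpace ℂ K]

/-- A point of the closure of the graph whose first coordinate lies in the domain belongs to the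
graph: its other coordinates are determined by pairing with the dense domain. -/
theorem apply_eq_of_mem_closure (π : StarRep A K) {p : K × (A → K)}
    (hp : p ∈ closure (Set.range π.graphMap)) (h : p.1 ∈ π.domain) : π.graphMap ⟨p.1, h⟩ = p := by
  have key : ∀ (a : A) (ψ : π.domain),
      inner ℂ (p.2 a) (ψ : K) = inner ℂ p.1 (π.toHom (star a) ψ : K) := by
    intro a ψ
    have hc : IsClosed {q : K × (A → K) |
        inner ℂ (q.2 a) (ψ : K) = inner ℂ q.1 (π.toHom (star a) ψ : K)} :=
      isClosed_eq (by fun_prop) (by fun_prop)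
    exact closure_minimal (by rintro _ ⟨φ, rfl⟩; exact π.inner_toHom a φ ψ) hc hp
  refine Prod.ext rfl (funext fun a => ?_)
  refine π.dense.eq_of_inner_left (𝕜 := ℂ) fun ψ hψ => ?_
  exact (π.inner_toHom a ⟨p.1, h⟩ ⟨ψ, hψ⟩).trans (key a ⟨ψ, hψ⟩).symm

/-- Completeness of the graph topology, as a condition on first coordinates only. -/
theorem isClosedRep_iff [CompleteSpace K] (π : StarRep A K) :
    π.IsClosedRep ↔ ∀ p ∈ closure (Set.range π.graphMap), p.1 ∈ π.domain := by
  have h : @IsUniformInducing _ _ π.graphUniformity _ π.graphMap :=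
    @IsUniformInducing.mk _ _ π.graphUniformity _ _ rfl
  rw [IsClosedRep, @completeSpace_iff_isComplete_range _ _ π.graphUniformity _ _ h,
    (show IsComplete (Set.range π.graphMap) ↔ IsClosed (Set.range π.graphMap) from
      ⟨IsComplete.isClosed, IsClosed.isComplete⟩), ← closure_subset_iff_isClosed]
  constructor
  · rintro hc p hp
    obtain ⟨φ, rfl⟩ := hc hp
    exact φ.2
  · intro hc p hp
    exact ⟨⟨p.1, hc p hp⟩, π.apply_eq_of_mem_closure hp (hc p hp)⟩

theorem mem_graphClosure_iff (π : StarRep A K) {S : Set π.domain} {φ : π.domain} :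
    φ ∈ @closure π.domain π.graphUniformity.toTopologicalSpace S ↔
      π.graphMap φ ∈ closure (π.graphMap '' S) :=
  closure_induced (f := π.graphMap)

/-- The graph topology only gets finer when the algebra is enlarged, so closedness is inherited from
a subalgebra. -/
theorem IsClosedRep.of_comp [CompleteSpace K] {π : StarRep A K}
    {C : Type*} [Ring C] [StarRing C] [Algebra ℂ C] {j : C →⋆ₐ[ℂ] A}
    (h : (π.comp j).IsClosedRep) : π.IsClosedRep := by
  rw [isClosedRep_iff] at h ⊢
  intro p hp
  refine h (p.1, fun c => p.2 (j c)) (map_mem_closure (f := fun q : K × (A → K) =>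
    (q.1, fun c => q.2 (j c))) (by fun_prop) hp ?_)
  rintro _ ⟨φ, rfl⟩
  exact ⟨φ, rfl⟩

section Op

theorem op_le_adjoint [CompleteSpace K] (π : StarRep A K) (a : A) :
    π.op a ≤ (π.op (star a)).adjoint := by
  refine LinearPMap.IsFormalAdjoint.le_adjoint π.dense ?_
  intro φ ψ
  have := π.inner_toHom (star a) φ ψ
  rwa [star_star] at this

theorem isClosable_op [CompleteSpace K] (π : StarRep A K) (a : A) : (π.op a).IsClosable :=
  ((LinearPMap.adjoint_isClosed π.dense).isClosable).leIsClosable (π.op_le_adjoint a)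

theorem mem_graph_op {π : StarRep A K} {a : A} {p : K × K} :
    p ∈ (π.op a).graph ↔ ∃ φ : π.domain, ((φ : K), (π.toHom a φ : K)) = p := by
  rw [LinearPMap.mem_graph_iff']; rfl

end Op

section Reduce

variable (σ : StarRep A K) (M : Submodule ℂ K) [M.HasOrthogonalProjection]
  (hM : ∀ a, σ.Intertwines a M.starProjection M.starProjection)

theorem toHom_mem_of_mem (hM : ∀ a, σ.Intertwines a M.starProjection M.starProjection) (a : A)
    {φ : σ.domain} (hφ : (φ : K) ∈ M) :
    (σ.toHom a φ : K) ∈ M := by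
  obtain ⟨h, e⟩ := hM a φ
  have : (⟨M.starProjection φ, h⟩ : σ.domain) = φ :=
    Subtype.ext (Submodule.starProjection_eq_self_iff.2 hφ)
  rw [this] at e
  exact Submodule.starProjection_eq_self_iff.1 e.symm

/-- The part of a `*`-representation on a closed subspace `M` that reduces it, with domain
`D(σ) ∩ M`. -/
noncomputable def reduce : StarRep A M where
  domain := σ.domain.comap M.subtype
  dense := by
    rw [dense_iff_closure_eq, Set.eq_univ_iff_forall]
    intro x
    have hx : M.orthogonalProjectionOnto (x : K) = x := by simp
    rw [← hx]
    refine map_mem_closure (f := M.orthogonalProjectionOnto) (by fun_prop) (σ.dense (x : K)) ?_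
    intro φ hφ
    exact (hM 0 ⟨φ, hφ⟩).1
  toHom :=
  { toFun := fun a =>
      ((σ.domain.subtype ∘ₗ σ.toHom a ∘ₗ M.subtype.restrict fun _ h => h).codRestrict M
        fun φ => σ.toHom_mem_of_mem M hM a φ.1.2).codRestrict _ fun φ => (σ.toHom a _).2
    map_smul' := fun c a => by ext φ; simp; rfl
    map_zero' := by ext φ; simp
    map_add' := fun a b => by ext φ; simp; rfl
    map_mul' := fun a b => by ext φ; simp; rfl }
  inner_toHom := fun a φ ψ => σ.inner_toHom a ⟨(φ : M), φ.2⟩ ⟨(ψ : M), ψ.2⟩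

variable {σ M}

theorem IsClosedRep.reduce [CompleteSpace K] [CompleteSpace M] (h : σ.IsClosedRep) :
    (σ.reduce M hM).IsClosedRep := by
  rw [isClosedRep_iff] at h ⊢
  intro p hp
  refine h ((p.1 : K), fun a => (p.2 a : K)) (map_mem_closure (f := fun q : M × (A → M) =>
    ((q.1 : K), fun a => (q.2 a : K))) (by fun_prop) hp ?_)
  rintro _ ⟨φ, rfl⟩
  exact ⟨⟨(φ : M), φ.2⟩, rfl⟩

/-- The projection onto a reducing subspace maps the graph of the closure of `σ(a)` into the
graph of the closure of its part. -/
theorem mem_graph_closure_reduce_of [CompleteSpace K] [CompleteSpace M] (a : A) {x y : K}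
    (h : (x, y) ∈ (σ.op a).closure.graph) :
    (M.orthogonalProjectionOnto x, M.orthogonalProjectionOnto y) ∈
      ((σ.reduce M hM).op a).closure.graph := by
  rw [← (isClosable_op _ a).graph_closure_eq_closure_graph] at h ⊢
  refine map_mem_closure (f := fun q : K × K =>
    (M.orthogonalProjectionOnto q.1, M.orthogonalProjectionOnto q.2)) (by fun_prop) h ?_
  intro q hq
  obtain ⟨φ, rfl⟩ := mem_graph_op.1 hq
  obtain ⟨h, e⟩ := hM a φ
  exact mem_graph_op.2 ⟨⟨M.orthogonalProjectionOnto φ, h⟩, Prod.ext rfl (Subtype.ext e)⟩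

theorem mem_graph_closure_reduce [CompleteSpace K] [CompleteSpace M] (a : A) (x y : M) :
    (x, y) ∈ ((σ.reduce M hM).op a).closure.graph ↔
      ((x : K), (y : K)) ∈ (σ.op a).closure.graph := by
  constructor
  · intro h
    rw [← (isClosable_op _ a).graph_closure_eq_closure_graph] at h ⊢
    refine map_mem_closure (f := fun q : M × M => ((q.1 : K), (q.2 : K))) (by fun_prop) h ?_
    intro q hq
    obtain ⟨φ, rfl⟩ := mem_graph_op.1 hq
    exact mem_graph_op.2 ⟨⟨(φ : M), φ.2⟩, rfl⟩
  · intro h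
    have := mem_graph_closure_reduce_of hM a h
    rwa [M.orthogonalProjectionOnto_mem_subspace_eq_self,
      M.orthogonalProjectionOnto_mem_subspace_eq_self] at this

theorem mem_graph_adjoint [CompleteSpace K] (σ : StarRep A K) (a : A) (x y : K) :
    (x, y) ∈ (σ.op a).adjoint.graph ↔
      ∀ φ : σ.domain, inner ℂ (σ.toHom a φ : K) x = inner ℂ (φ : K) y := by
  have hd : Dense ((σ.op a).domain : Set K) := σ.dense
  rw [LinearPMap.adjoint_graph_eq_graph_adjoint hd, Submodule.mem_adjoint_iff]
  constructor
  · intro h φ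
    exact sub_eq_zero.1 (h _ _ (mem_graph_op.2 ⟨φ, rfl⟩))
  · intro h u v huv
    obtain ⟨φ, e⟩ := mem_graph_op.1 huv
    obtain ⟨rfl, rfl⟩ := Prod.ext_iff.1 e
    exact sub_eq_zero.2 (h φ)

theorem mem_graph_adjoint_reduce [CompleteSpace K] [CompleteSpace M] (a : A) (x y : M) :
    (x, y) ∈ ((σ.reduce M hM).op a).adjoint.graph ↔
      ((x : K), (y : K)) ∈ (σ.op a).adjoint.graph := by
  rw [mem_graph_adjoint, mem_graph_adjoint]
  constructor
  · intro h φ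
    obtain ⟨h', e⟩ := hM a φ
    have h1 := h ⟨M.orthogonalProjectionOnto φ, h'⟩
    have h2 : inner ℂ (σ.toHom a ⟨M.starProjection φ, h'⟩ : K) (x : K)
        = inner ℂ (M.starProjection (φ : K)) (y : K) := h1
    rwa [e, M.inner_starProjection_left_eq_right, M.inner_starProjection_left_eq_right,
      M.starProjection_mem_subspace_eq_self, M.starProjection_mem_subspace_eq_self] at h2
  · intro h φ
    exact h ⟨(φ : M), φ.2⟩

theorem IsIntegrable.reduce [CompleteSpace K] [CompleteSpace M] (h : σ.IsIntegrable) :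
    (σ.reduce M hM).IsIntegrable := by
  refine ⟨h.1.reduce hM, fun b => LinearPMap.eq_of_eq_graph (Submodule.ext ?_)⟩
  rintro ⟨x, y⟩
  rw [mem_graph_closure_reduce, mem_graph_adjoint_reduce, h.2]

end Reduce

end StarRep

/-! ### Parts of spectral measures and of well-behaved representations -/

namespace StarRep

variable {A : Type*} [Ring A] [StarRing A] [Algebra ℂ A]
  {K : Type*} [NormedAddCommGroup K] [InnerProductSpace ℂ K] [CompleteSpace K]
  {σ : StarRep A K} {M : Submodule ℂ K} [M.HasOrthogonalProjection] [CompleteSpace M]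
  (hM : ∀ a, σ.Intertwines a M.starProjection M.starProjection)

theorem mem_domain_closure_reduce (a : A) (x : M) :
    x ∈ ((σ.reduce M hM).op a).closure.domain ↔ (x : K) ∈ (σ.op a).closure.domain := by
  rw [LinearPMap.mem_domain_iff, LinearPMap.mem_domain_iff]
  refine ⟨fun ⟨y, h⟩ => ⟨y, (mem_graph_closure_reduce hM a x y).1 h⟩, fun ⟨y, h⟩ => ?_⟩
  have := mem_graph_closure_reduce_of hM a h
  rw [M.orthogonalProjectionOnto_mem_subspace_eq_self] at this
  exact ⟨_, this⟩

theorem closure_reduce_apply (a : A) (x : ((σ.reduce M hM).op a).closure.domain)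
    (h : ((x : M) : K) ∈ (σ.op a).closure.domain) :
    (((σ.reduce M hM).op a).closure x : K) = (σ.op a).closure ⟨(x : M), h⟩ :=
  LinearPMap.mem_graph_snd_inj _ ((mem_graph_closure_reduce hM a _ _).1 (LinearPMap.mem_graph _ x))
    (LinearPMap.mem_graph _ ⟨((x : M) : K), h⟩) rfl

end StarRep

namespace SpectralMeasure

variable {X : Type*} [MeasurableSpace X]
  {K : Type*} [NormedAddCommGroup K] [InnerProductSpace ℂ K] [CompleteSpace K]
  (E : SpectralMeasure X K) (M : Submodule ℂ K) [M.HasOrthogonalProjection] [CompleteSpace M]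

theorem diag_apply (φ : K) {s : Set X} (hs : MeasurableSet s) :
    E.diag φ s = ENNReal.ofReal (inner ℂ φ (E.proj s φ)).re :=
  MeasureTheory.Measure.ofMeasurable_apply s hs

variable (hE : ∀ s, MeasurableSet s → ∀ x ∈ M, E.proj s x ∈ M)

/-- The part of a spectral measure on a closed subspace that is invariant under its
projections. -/
noncomputable def reduce : SpectralMeasure X M :=
  have coe {s : Set X} (hs : MeasurableSet s) (x : M) :
      ((M.orthogonalProjectionOnto ∘L E.proj s ∘L M.subtypeL) x : K) = E.proj s x :=
    Submodule.starProjection_eq_self_iff.2 (hE s hs x x.2)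
  { proj := fun s => M.orthogonalProjectionOnto ∘L E.proj s ∘L M.subtypeL
    isStarProjection := fun s hs => by
      have hp := E.isStarProjection s hs
      constructor
      · ext x
        rw [mul_apply_eq_comp, coe hs, coe hs, ← mul_apply_eq_comp,
          hp.isIdempotentElem.eq]
      · rw [ContinuousLinearMap.isSelfAdjoint_iff_isSymmetric]
        intro x y
        have h := ContinuousLinearMap.isSelfAdjoint_iff_isSymmetric.1 hp.isSelfAdjoint (x : K) y
        exact (congrArg (inner ℂ · (y : K)) (coe hs x)).trans
          (h.trans (congrArg (inner ℂ (x : K)) (coe hs y).symm))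
    univ := by
      ext x
      rw [coe MeasurableSet.univ, E.univ]
      rfl
    hasSum := fun s hs hd x => by
      have := (E.hasSum s hs hd x).mapL M.orthogonalProjectionOnto
      exact this }

theorem coe_reduce_proj {s : Set X} (hs : MeasurableSet s) (x : M) :
    ((E.reduce M hE).proj s x : K) = E.proj s x :=
  Submodule.starProjection_eq_self_iff.2 (hE s hs x x.2)

theorem diag_reduce (x : M) : (E.reduce M hE).diag x = E.diag (x : K) := by
  ext s hs
  rw [diag_apply _ _ hs, diag_apply _ _ hs, Submodule.coe_inner, coe_reduce_proj _ _ _ hs]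

end SpectralMeasure

section

variable {G : Type*} [Group G] {A : Type*} [Ring A] [StarRing A] [Algebra ℂ A] [StarModule ℂ A]
  {𝒢 : StarGrading G A}
  {K : Type*} [NormedAddCommGroup K] [InnerProductSpace ℂ K] [CompleteSpace K]

theorem IsGivenBy.reduce {σ : StarRep 𝒢.base K} {E : SpectralMeasure 𝒢.PosChar K}
    (h : IsGivenBy 𝒢 σ E) (M : Submodule ℂ K) [M.HasOrthogonalProjection] [CompleteSpace M]
    (hM : ∀ a, σ.Intertwines a M.starProjection M.starProjection)
    (hE : ∀ s, MeasurableSet s → ∀ x ∈ M, E.proj s x ∈ M) :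
    IsGivenBy 𝒢 (σ.reduce M hM) (E.reduce M hE) := by
  refine ⟨h.1.reduce hM, fun b => ⟨fun x => ?_, fun x => ?_⟩⟩
  · rw [StarRep.mem_domain_closure_reduce, E.diag_reduce]
    exact (h.2 b).1 x
  · have hx := (StarRep.mem_domain_closure_reduce hM b (x : M)).1 x.2
    rw [Submodule.coe_inner, StarRep.closure_reduce_apply hM b x hx, E.diag_reduce]
    exact (h.2 b).2 ⟨_, hx⟩

/-- Homomorphisms `A →ₙₐ End D` need not preserve the unit, but integration of `χ(1) = 1` against a
spectral measure forces `σ(1) = I`. -/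
theorem IsGivenBy.toHom_one {σ : StarRep 𝒢.base K} {E : SpectralMeasure 𝒢.PosChar K}
    (h : IsGivenBy 𝒢 σ E) (φ : σ.domain) : σ.toHom 1 φ = φ := by
  have key : ∀ ψ : σ.domain, σ.toHom 1 ψ = 0 → ψ = 0 := by
    intro ψ hψ
    have hle := (σ.op 1).le_closure
    have h1 := (h.2 1).2 ⟨(ψ : K), hle.1 ψ.2⟩
    have h2 : (σ.op 1).closure ⟨(ψ : K), hle.1 ψ.2⟩ = (0 : K) := by
      rw [← hle.2 (x := ψ) rfl]
      exact congrArg Subtype.val hψ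
    have h3 : (E.diag (ψ : K)).real Set.univ = ‖(ψ : K)‖ ^ 2 := by
      rw [MeasureTheory.measureReal_def, E.diag_apply _ MeasurableSet.univ, E.univ]
      simp [inner_self_eq_norm_sq_to_K, ← Complex.ofReal_pow]
    rw [h2] at h1
    simp only [inner_zero_right, MeasureTheory.integral_const, map_one, h3] at h1
    have h4 : ‖(ψ : K)‖ ^ 2 = 0 := by simpa using h1.symm
    exact Subtype.ext (norm_eq_zero.1 (pow_eq_zero_iff two_ne_zero |>.1 h4))
  -- `σ(1)` is idempotent, so it annihilates `φ - σ(1)φ`.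
  have hz := key (φ - σ.toHom 1 φ) (by
    rw [map_sub, ← Module.End.mul_apply, ← map_mul, mul_one, sub_self])
  exact (sub_eq_zero.1 hz).symm

theorem WellBehavedWith.wellBehavedSub_reduce {π : StarRep A K} {F : SpectralMeasure 𝒢.PosChar K}
    (h : WellBehavedWith 𝒢 π F) (H : Subgroup G) (M : Submodule ℂ K)
    [M.HasOrthogonalProjection] [CompleteSpace M]
    (hM : ∀ a, (π.comp (𝒢.sub H).subtype).Intertwines a M.starProjection M.starProjection)
    (hF : ∀ s, MeasurableSet s → ∀ x ∈ M, F.proj s x ∈ M) :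
    WellBehavedSub 𝒢 H ((π.comp (𝒢.sub H).subtype).reduce M hM) := by
  refine ⟨F.reduce M hF,
    h.1.reduce M (fun a => hM (StarSubalgebra.inclusion (𝒢.base_le_sub H) a)) hF, ?_⟩
  intro g hg a ha Δ hΔ φ
  obtain ⟨h', e⟩ := h.2 g a ha Δ hΔ ⟨(φ : M), φ.2⟩
  have hc : ((F.reduce M hF).proj Δ φ : K) = F.proj Δ (φ : M) := F.coe_reduce_proj M hF hΔ _
  have hd : (F.reduce M hF).proj Δ φ ∈ ((π.comp (𝒢.sub H).subtype).reduce M hM).domain := by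
    change ((F.reduce M hF).proj Δ φ : K) ∈ π.domain
    rwa [hc]
  have hr : (⟨F.proj Δ (φ : M), h'⟩ : π.domain) = ⟨_, hd⟩ := Subtype.ext hc.symm
  rw [hr] at e
  refine ⟨hd, ?_⟩
  rw [← M.orthogonalProjectionOnto_mem_subspace_eq_self
    (((π.comp (𝒢.sub H).subtype).reduce M hM).toHom a ⟨_, hd⟩ : M)]
  exact congrArg M.orthogonalProjectionOnto e

end

/-! ### Closed representations that contain a given core; the conditional expectation -/

section

variable {A : Type*} [Ring A] [StarRing A] [Algebra ℂ A]
  {K : Type*} [NormedAddCommGroup K] [InnerProductSpace ℂ K]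
  {K' : Type*} [NormedAddCommGroup K'] [InnerProductSpace ℂ K']
  {V : Type*} [AddCommGroup V] [Module ℂ V]

section ClosureOfCore

variable {ι : V →ₗ[ℂ] K} {α : A →ₙₐ[ℂ] Module.End ℂ V} (hι : DenseRange ι)
  (hα : ∀ a v w, inner ℂ (ι (α a v)) (ι w) = inner ℂ (ι v) (ι (α (star a) w)))

theorem mem_domain_closureOfCore {φ : K} :
    φ ∈ (closureOfCore ι α hι hα).domain ↔ ∃ Φ, (φ, Φ) ∈ coreGraph ι α := by
  constructor
  · rintro ⟨⟨φ, Φ⟩, h, rfl⟩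
    exact ⟨Φ, h⟩
  · rintro ⟨Φ, h⟩
    exact ⟨_, h, rfl⟩

theorem graphMap_closureOfCore_mem (φ : (closureOfCore ι α hι hα).domain) :
    (closureOfCore ι α hι hα).graphMap φ ∈ coreGraph ι α :=
  ((mem_domain_closureOfCore hι hα).1 φ.2).choose_spec

theorem closureOfCore_apply {φ : K} {Φ : A → K} (h : (φ, Φ) ∈ coreGraph ι α)
    (hφ : φ ∈ (closureOfCore ι α hι hα).domain) (a : A) :
    ((closureOfCore ι α hι hα).toHom a ⟨φ, hφ⟩ : K) = Φ a :=
  congrFun (coreGraph_unique hι hα (graphMap_closureOfCore_mem hι hα ⟨φ, hφ⟩) h) a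

/-- If `j` is a graph-dense copy of the core in a closed `*`-representation `π`, then `π` is
unitarily equivalent to the closure of the core. -/
theorem exists_unitary_closureOfCore [CompleteSpace K] [CompleteSpace K'] {π : StarRep A K'}
    (hπ : π.IsClosedRep)
    (j : V →ₗ[ℂ] π.domain) (hj : ∀ a v, j (α a v) = π.toHom a (j v))
    (hinner : ∀ v, ‖ι v‖ = ‖(j v : K')‖)
    (hdense : ∀ φ : π.domain,
      φ ∈ @closure π.domain π.graphUniformity.toTopologicalSpace (Set.range j)) :
    ∃ U : K' ≃ₗᵢ[ℂ] K, (∀ v, U (j v) = ι v) ∧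
      (∀ φ : K', φ ∈ π.domain ↔ U φ ∈ (closureOfCore ι α hι hα).domain) ∧
      ∀ (a : A) (φ : π.domain) (h : U φ ∈ (closureOfCore ι α hι hα).domain),
        U (π.toHom a φ) = ((closureOfCore ι α hι hα).toHom a ⟨U φ, h⟩ : K) := by
  have hjd : DenseRange (π.domain.subtype ∘ₗ j) := by
    rw [DenseRange, dense_iff_closure_eq, Set.eq_univ_iff_forall]
    intro x
    refine closure_minimal ?_ isClosed_closure (π.dense x)
    intro φ hφ
    refine map_mem_closure continuous_fst (π.mem_graphClosure_iff.1 (hdense ⟨φ, hφ⟩)) ?_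
    rintro _ ⟨_, ⟨v, rfl⟩, rfl⟩
    exact ⟨v, rfl⟩
  let U : K' ≃ₗᵢ[ℂ] K := (LinearEquiv.refl ℂ V).extendOfIsometry (π.domain.subtype ∘ₗ j) ι hjd hι
    hinner
  have hU : ∀ v, U (j v) = ι v := fun v =>
    LinearEquiv.extendOfIsometry_eq (LinearEquiv.refl ℂ V) (π.domain.subtype ∘ₗ j) ι hjd hι hinner v
  have hUs : ∀ v, U.symm (ι v) = j v := fun v => by rw [← hU, U.symm_apply_apply]
  have hmem : ∀ φ : π.domain, (U φ, fun a => U (π.toHom a φ)) ∈ coreGraph ι α := by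
    intro φ
    refine map_mem_closure (f := fun q : K' × (A → K') => (U q.1, fun a => U (q.2 a)))
      (by fun_prop) (π.mem_graphClosure_iff.1 (hdense φ)) ?_
    rintro _ ⟨_, ⟨v, rfl⟩, rfl⟩
    refine ⟨v, Prod.ext (hU v).symm (funext fun a => ?_)⟩
    change ι (α a v) = U (π.toHom a (j v))
    rw [← hj, hU]
  refine ⟨U, hU, fun φ => ⟨fun hφ => ?_, fun hφ => ?_⟩, fun a φ h => ?_⟩
  · exact (mem_domain_closureOfCore hι hα).2 ⟨_, hmem ⟨φ, hφ⟩⟩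
  · obtain ⟨Φ, h⟩ := (mem_domain_closureOfCore hι hα).1 hφ
    rw [← U.symm_apply_apply φ]
    refine π.isClosedRep_iff.1 hπ (U.symm (U φ), fun a => U.symm (Φ a)) (map_mem_closure
      (f := fun q : K × (A → K) => (U.symm q.1, fun a => U.symm (q.2 a))) (by fun_prop) h ?_)
    rintro _ ⟨v, rfl⟩
    refine ⟨j v, Prod.ext (hUs v).symm (funext fun a => ?_)⟩
    change (π.toHom a (j v) : K') = U.symm (ι (α a v))
    rw [← hj, hUs]
  · exact (closureOfCore_apply hι hα (hmem φ) h a).symm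

end ClosureOfCore

end

section

variable {G : Type*} [Group G] {A : Type*} [Ring A] [StarRing A] [Algebra ℂ A]
  {𝒢 : StarGrading G A} {H : Subgroup G}

theorem setOf_mk_eq_one : {g : G | (g : G ⧸ H) = ((1 : G) : G ⧸ H)} = (H : Set G) := by
  ext g
  rw [Set.mem_ofPred_eq, eq_comm, QuotientGroup.eq]
  simp

theorem StarGrading.proj_eq_self {X : Set G} {a : A} (ha : a ∈ 𝒢.sum X) : 𝒢.proj X a = a := by
  have hle : 𝒢.sum X ≤ LinearMap.eqLocus (𝒢.proj X) LinearMap.id :=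
    iSup₂_le fun g hg a ha => 𝒢.proj_of_mem _ ha hg
  exact hle ha

theorem StarGrading.proj_mul [StarModule ℂ A] {b : A} (hb : b ∈ 𝒢.sub H) (x : A) :
    𝒢.proj H (b * x) = b * 𝒢.proj H x := by
  have hb' : b ∈ 𝒢.sum (H : Set G) := hb
  have hle : 𝒢.sum (H : Set G) ≤ LinearMap.eqLocus (𝒢.proj H ∘ₗ (LinearMap.mul ℂ A).flip x)
      ((LinearMap.mul ℂ A).flip (𝒢.proj H x)) := by
    refine iSup₂_le fun h hh b hb => ?_
    change 𝒢.proj H (b * x) = b * 𝒢.proj H x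
    refine 𝒢.induction (P := fun x => 𝒢.proj H (b * x) = b * 𝒢.proj H x) x (fun g x hx => ?_)
      (by simp) (fun x y hx hy => by rw [mul_add, map_add, hx, hy, map_add, mul_add])
    by_cases hg : g ∈ H
    · rw [𝒢.proj_of_mem _ hx hg, 𝒢.proj_of_mem _ (𝒢.mul_mem hb hx) (H.mul_mem hh hg)]
    · rw [𝒢.proj_of_notMem _ hx hg, 𝒢.proj_of_notMem _ (𝒢.mul_mem hb hx)
        (fun h' => hg ((H.mul_mem_cancel_left hh).1 h')), mul_zero]
  exact hle hb'

theorem StarGrading.condExp_mul [StarModule ℂ A] (b : 𝒢.sub H) (x : A) :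
    𝒢.condExp H (b * x) = b * 𝒢.condExp H x :=
  Subtype.ext (StarGrading.proj_mul b.2 x)

end

/-! ### The representation on `D_H(π)` induces the given system -/

section

variable {A : Type*} [Ring A] [StarRing A] [Algebra ℂ A]
  {K : Type*} [NormedAddCommGroup K] [InnerProductSpace ℂ K]

/-- The graph map `φ ↦ (φ, (π(a)φ)_a)` as a linear map. -/
def StarRep.graphMapₗ (π : StarRep A K) : π.domain →ₗ[ℂ] K × (A → K) :=
  π.domain.subtype.prod (LinearMap.pi fun a => π.domain.subtype ∘ₗ π.toHom a)

/-- Intertwining relations for homogeneous elements extend to `A_X`. The hypothesis `hP` keeps the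
relation meaningful for `X = ∅`. -/
theorem StarRep.Intertwines.of_mem_sum {G : Type*} [Group G] {𝒢 : StarGrading G A}
    {π : StarRep A K} {P Q : K →L[ℂ] K} (hP : ∀ φ : π.domain, P φ ∈ π.domain) {X : Set G}
    (h : ∀ g ∈ X, ∀ a ∈ 𝒢.part g, π.Intertwines a P Q) {a : A} (ha : a ∈ 𝒢.sum X) :
    π.Intertwines a P Q := by
  let S : Submodule ℂ A :=
    { carrier := {a | ∀ φ : π.domain, (π.toHom a ⟨P φ, hP φ⟩ : K) = Q (π.toHom a φ)}
      zero_mem' := fun φ => by simp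
      add_mem' := fun {a b} ha hb φ => by simpa using congrArg₂ (· + ·) (ha φ) (hb φ)
      smul_mem' := fun c a ha φ => by simpa using congrArg (c • ·) (ha φ) }
  have hle : 𝒢.sum X ≤ S := iSup₂_le fun g hg a ha φ => (h g hg a ha φ).2
  exact fun φ => ⟨hP φ, hle ha φ⟩

end

section

variable {G : Type*} [Group G] {A : Type*} [Ring A] [StarRing A] [Algebra ℂ A]
  {𝒢 : StarGrading G A} {H : Subgroup G}
  {K : Type*} [NormedAddCommGroup K] [InnerProductSpace ℂ K] {π : StarRep A K}
variable [StarModule ℂ A] {M : Submodule ℂ K} [M.HasOrthogonalProjection]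
  (hM : ∀ a, (π.comp (𝒢.sub H).subtype).Intertwines a M.starProjection M.starProjection)

/-- The map `x ⊗ φ ↦ π(x)φ` of `A ⊗ D(ρ)` into `D(π)`, where `ρ` is the part of the restriction of
`π` to `A_H` on a reducing subspace `M`. -/
noncomputable def actionMap :
    (A ⊗[ℂ] ((π.comp (𝒢.sub H).subtype).reduce M hM).domain) →ₗ[ℂ] π.domain :=
  TensorProduct.lift (LinearMap.mk₂ ℂ (fun a φ => π.toHom a ⟨((φ : M) : K), φ.2⟩)
    (fun a b φ => by rw [map_add]; rfl)
    (fun c a φ => by rw [map_smul]; rfl)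
    (fun a φ ψ => (π.toHom a).map_add ⟨((φ : M) : K), φ.2⟩ ⟨((ψ : M) : K), ψ.2⟩)
    (fun c a φ => (π.toHom a).map_smul c ⟨((φ : M) : K), φ.2⟩))

theorem actionMap_tmul (a : A) (φ : ((π.comp (𝒢.sub H).subtype).reduce M hM).domain) :
    actionMap hM (a ⊗ₜ φ) = π.toHom a ⟨((φ : M) : K), φ.2⟩ := rfl

theorem actionMap_indAction (a : A)
    (ξ : A ⊗[ℂ] ((π.comp (𝒢.sub H).subtype).reduce M hM).domain) :
    actionMap hM (indAction _ a ξ) = π.toHom a (actionMap hM ξ) := by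
  induction ξ with
  | zero => simp
  | add ξ η h h' => rw [map_add, map_add, h, h', map_add, map_add]
  | tmul x φ =>
    have h1 : indAction ((π.comp (𝒢.sub H).subtype).reduce M hM) a (x ⊗ₜ φ) = (a * x) ⊗ₜ φ := rfl
    rw [h1, actionMap_tmul, actionMap_tmul, map_mul]
    rfl

end

section

variable {G : Type*} [Group G] {A : Type*} [Ring A] [StarRing A] [Algebra ℂ A]
  {𝒢 : StarGrading G A} {H : Subgroup G}
  {K : Type*} [NormedAddCommGroup K] [InnerProductSpace ℂ K] [CompleteSpace K]
  {π : StarRep A K} {E : G ⧸ H → (K →L[ℂ] K)}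

namespace IsSystem

theorem apply_mem_domain (hsys : IsSystem 𝒢 π E) (t : G ⧸ H) (φ : π.domain) :
    E t φ ∈ π.domain :=
  (hsys.intertwines 1 t 0 (zero_mem _) φ).1

theorem apply_apply (hsys : IsSystem 𝒢 π E) (t : G ⧸ H) (φ : K) : E t (E t φ) = E t φ := by
  rw [← mul_apply_eq_comp, (hsys.isStarProjection t).isIdempotentElem.eq]

theorem inner_apply (hsys : IsSystem 𝒢 π E) (t : G ⧸ H) (φ ψ : K) :
    inner ℂ (E t φ) ψ = inner ℂ φ (E t ψ) :=
  ContinuousLinearMap.isSelfAdjoint_iff_isSymmetric.1 (hsys.isStarProjection t).isSelfAdjoint φ ψ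

theorem mem_component_iff (hsys : IsSystem 𝒢 π E) {t : G ⧸ H} {φ : π.domain} :
    φ ∈ component π E t ↔ E t φ = φ := by
  constructor
  · rintro ⟨ψ, hψ⟩
    change E t ψ = φ at hψ
    rw [← hψ, hsys.apply_apply]
  · intro h
    exact ⟨φ, h⟩

theorem intertwines_sum (hsys : IsSystem 𝒢 π E) {s t : G ⧸ H} {X : Set G}
    (hX : ∀ g ∈ X, g • s = t) {a : A} (ha : a ∈ 𝒢.sum X) : π.Intertwines a (E s) (E t) :=
  .of_mem_sum (hsys.apply_mem_domain s)
    (fun g hg b hb => hX g hg ▸ hsys.intertwines g s b hb) ha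

theorem toHom_mem_component (hsys : IsSystem 𝒢 π E) {s t : G ⧸ H} {X : Set G}
    (hX : ∀ g ∈ X, g • s = t) {a : A} (ha : a ∈ 𝒢.sum X) {φ : π.domain}
    (hφ : φ ∈ component π E s) : π.toHom a φ ∈ component π E t := by
  rw [hsys.mem_component_iff] at hφ ⊢
  obtain ⟨h, e⟩ := hsys.intertwines_sum hX ha φ
  rw [← e]
  exact congrArg (fun ψ : π.domain => (π.toHom a ψ : K)) (Subtype.ext hφ)

theorem hasSum_toHom (hsys : IsSystem 𝒢 π E) (φ : π.domain) (a : A) :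
    HasSum (fun t => (π.toHom a ⟨E t φ, hsys.apply_mem_domain t φ⟩ : K)) (π.toHom a φ : K) := by
  refine 𝒢.induction (P := fun a =>
    HasSum (fun t => (π.toHom a ⟨E t φ, hsys.apply_mem_domain t φ⟩ : K)) (π.toHom a φ : K))
    a (fun g a ha => ?_) ?_ (fun a b ha hb => ?_)
  · have h := (MulAction.toPerm g : Equiv.Perm (G ⧸ H)).hasSum_iff.2 (hsys.hasSum (π.toHom a φ))
    convert h using 2 with t
    exact (hsys.intertwines g t a ha φ).2
  · simp
  · simpa using ha.add hb

/-- `∑ E(t) φ = φ` in the graph topology of `π`. -/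
theorem hasSum_graphMapₗ (hsys : IsSystem 𝒢 π E) (φ : π.domain) :
    HasSum (fun t => π.graphMapₗ ⟨E t φ, hsys.apply_mem_domain t φ⟩) (π.graphMapₗ φ) :=
  (hsys.hasSum φ).prodMk (Pi.hasSum.2 fun a => hsys.hasSum_toHom φ a)

theorem inner_eq_zero (hsys : IsSystem 𝒢 π E) {s t : G ⧸ H} (hst : s ≠ t) {φ ψ : π.domain}
    (hφ : φ ∈ component π E s) (hψ : ψ ∈ component π E t) : inner ℂ (φ : K) (ψ : K) = 0 := by
  rw [hsys.mem_component_iff] at hφ hψ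
  have h : E s (E t ψ) = 0 := by rw [← mul_apply_eq_comp, hsys.mul_eq_zero _ _ hst]; rfl
  calc inner ℂ (φ : K) (ψ : K) = inner ℂ (E s φ) (E t ψ) := by rw [hφ, hψ]
    _ = 0 := by rw [hsys.inner_apply, h, inner_zero_right]

/-- Only the `H`-component of `z` contributes to matrix coefficients `⟨φ, π(z)ψ⟩` between vectors
of `D_H(π)`. -/
theorem inner_toHom_proj (hsys : IsSystem 𝒢 π E) {φ ψ : π.domain}
    (hφ : φ ∈ component π E ((1 : G) : G ⧸ H)) (hψ : ψ ∈ component π E ((1 : G) : G ⧸ H)) (z : A) :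
    inner ℂ (φ : K) (π.toHom (𝒢.proj H z) ψ : K) = inner ℂ (φ : K) (π.toHom z ψ : K) := by
  refine 𝒢.induction (P := fun z => inner ℂ (φ : K) (π.toHom (𝒢.proj H z) ψ : K) =
    inner ℂ (φ : K) (π.toHom z ψ : K)) z (fun g z hz => ?_) (by simp) (fun a b ha hb => ?_)
  · by_cases hg : g ∈ H
    · rw [𝒢.proj_of_mem _ hz hg]
    · rw [𝒢.proj_of_notMem _ hz hg]
      have h1 : π.toHom z ψ ∈ component π E (g : G ⧸ H) :=
        hsys.toHom_mem_component (X := {g}) (fun k hk => by rw [Set.mem_singleton_iff.1 hk]; simp)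
          (𝒢.part_le_sum (Set.mem_singleton g) hz) hψ
      have h2 : ((1 : G) : G ⧸ H) ≠ (g : G ⧸ H) := fun h => hg (by simpa using QuotientGroup.eq.1 h)
      rw [hsys.inner_eq_zero h2 hφ h1]
      simp
  · simp [ha, hb]

end IsSystem

section Core

variable [StarModule ℂ A] {M : Submodule ℂ K} [M.HasOrthogonalProjection]
  (hM : ∀ a, (π.comp (𝒢.sub H).subtype).Intertwines a M.starProjection M.starProjection)

theorem coe_mem_component (hsys : IsSystem 𝒢 π E) (hE : E ((1 : G) : G ⧸ H) = M.starProjection)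
    (φ : ((π.comp (𝒢.sub H).subtype).reduce M hM).domain) :
    (⟨((φ : M) : K), φ.2⟩ : π.domain) ∈ component π E ((1 : G) : G ⧸ H) := by
  rw [hsys.mem_component_iff, hE]
  exact M.starProjection_mem_subspace_eq_self (φ : M)

theorem inner_actionMap (hsys : IsSystem 𝒢 π E) (hE : E ((1 : G) : G ⧸ H) = M.starProjection)
    (ξ η : A ⊗[ℂ] ((π.comp (𝒢.sub H).subtype).reduce M hM).domain) :
    inner ℂ (actionMap hM ξ : K) (actionMap hM η : K) = indForm 𝒢 H _ ξ η := by
  have hcomp := coe_mem_component hM hsys hE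
  induction ξ with
  | zero => simp
  | add ξ ξ' h h' => simp [h, h']
  | tmul x φ =>
    induction η with
    | zero => simp
    | add η η' h h' => simp [h, h']
    | tmul y ψ =>
      rw [indForm_tmul, actionMap_tmul, actionMap_tmul, π.inner_toHom, ← Module.End.mul_apply,
        ← map_mul, ← hsys.inner_toHom_proj (hcomp φ) (hcomp ψ)]
      rfl

theorem inducible_reduce (hsys : IsSystem 𝒢 π E) (hE : E ((1 : G) : G ⧸ H) = M.starProjection) :
    Inducible 𝒢 H ((π.comp (𝒢.sub H).subtype).reduce M hM) := fun ξ => by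
  rw [← inner_actionMap hM hsys hE]
  exact inner_self_nonneg (𝕜 := ℂ)

/-- Non-degeneracy, in the form in which it enters: `π(A) D_H(π)` spans a graph-dense subspace of
the whole domain. -/
theorem IsNondegenerate.mem_closure_range_actionMap (hnd : IsNondegenerate 𝒢 π E)
    (hsys : IsSystem 𝒢 π E) (hE : E ((1 : G) : G ⧸ H) = M.starProjection) (φ : π.domain) :
    φ ∈ @closure π.domain π.graphUniformity.toTopologicalSpace (Set.range (actionMap hM)) := by
  rw [π.mem_graphClosure_iff]
  let C : Submodule ℂ (K × (A → K)) :=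
    ((LinearMap.range (actionMap hM)).map π.graphMapₗ).topologicalClosure
  have hC : ∀ t, ∀ φ ∈ component π E t, π.graphMapₗ φ ∈ C := by
    intro t φ hφ
    refine closure_mono (Set.image_mono ?_) (π.mem_graphClosure_iff.1 ((hnd t).2 hφ))
    refine Submodule.span_le.2 ?_
    rintro _ ⟨a, -, ψ, hψ, rfl⟩
    have hψM : (ψ : K) ∈ M := by
      rw [hsys.mem_component_iff, hE] at hψ
      exact Submodule.starProjection_eq_self_iff.1 hψ
    exact ⟨a ⊗ₜ ⟨⟨ψ, hψM⟩, ψ.2⟩, rfl⟩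
  have hmem : π.graphMapₗ φ ∈ C :=
    (Submodule.isClosed_topologicalClosure _).mem_of_tendsto (hsys.hasSum_graphMapₗ φ)
      (Filter.Eventually.of_forall fun s => C.sum_mem fun t _ =>
        hC t _ (hsys.mem_component_iff.2 (hsys.apply_apply t φ)))
  exact hmem

theorem systemEquivalent_reduce (hπ : π.IsClosedRep) (hsys : IsSystem 𝒢 π E)
    (hE : E ((1 : G) : G ⧸ H) = M.starProjection) (hnd : IsNondegenerate 𝒢 π E) :
    SystemEquivalent π E (ind (inducible_reduce hM hsys hE))
      (indProj (inducible_reduce hM hsys hE)) := by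
  have hρ := inducible_reduce hM hsys hE
  obtain ⟨U, hU, hdom, hact⟩ := exists_unitary_closureOfCore (denseRange_indClass hρ)
    (fun a ξ η => by rw [inner_indClass, inner_indClass, indForm_action]) hπ (actionMap hM)
    (actionMap_indAction hM) (fun ξ => by
      rw [norm_eq_sqrt_re_inner (𝕜 := ℂ), inner_indClass, norm_eq_sqrt_re_inner (𝕜 := ℂ),
        inner_actionMap hM hsys hE])
    (hnd.mem_closure_range_actionMap hM hsys hE)
  -- A dense subspace of `Ran E(t)`, namely `E(t) D(π)`, is approximated by `π(A_t) D_H(π)`, which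
  -- `U` maps to the vectors `[a ⊗ φ]` with `a ∈ A_t`.
  have hrange : ∀ (t : G ⧸ H) (N : Submodule ℂ (IndSpace hρ)),
      (∀ a ∈ 𝒢.sum {g : G | (g : G ⧸ H) = t}, ∀ ψ, indClass hρ (a ⊗ₜ ψ) ∈ N) →
      ∀ φ, U (E t φ) ∈ N.topologicalClosure := by
    intro t N hN φ
    refine closure_minimal (s := (π.domain : Set K)) (t := {φ | U (E t φ) ∈ N.topologicalClosure})
      (fun φ hφ => ?_) (N.isClosed_topologicalClosure.preimage (by fun_prop)) (π.dense φ)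
    have h := (hnd t).2 (hsys.mem_component_iff.2 (hsys.apply_apply t φ) :
      (⟨E t φ, hsys.apply_mem_domain t ⟨φ, hφ⟩⟩ : π.domain) ∈ component π E t)
    refine map_mem_closure (f := fun q : K × (A → K) => U q.1) (by fun_prop)
      (π.mem_graphClosure_iff.1 h) ?_
    rintro _ ⟨ξ, hξ, rfl⟩
    refine (Submodule.span_le
      (p := N.comap (U.toLinearEquiv.toLinearMap ∘ₗ π.domain.subtype))).2 ?_ hξ
    rintro _ ⟨a, ha, ψ, hψ, rfl⟩
    have hψM : (ψ : K) ∈ M := by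
      rw [hsys.mem_component_iff, hE] at hψ
      exact Submodule.starProjection_eq_self_iff.1 hψ
    have := hN a ha ⟨⟨ψ, hψM⟩, ψ.2⟩
    rw [← hU] at this
    exact this
  refine ⟨U, hdom, hact, fun t φ => (Submodule.eq_starProjection_of_mem_of_inner_eq_zero
    ?_ ?_).symm⟩
  · refine hrange t _ (fun a ha ψ => ?_) φ
    exact Submodule.subset_span ⟨a, ha, ψ, rfl⟩
  · intro w hw
    rw [← Submodule.mem_orthogonal_singleton_iff_inner_right]
    refine Submodule.topologicalClosure_minimal _ (Submodule.span_le.2 ?_)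
      (Submodule.isClosed_orthogonal _) hw
    rintro _ ⟨a, ha, ψ, rfl⟩
    have h := hsys.toHom_mem_component (t := t) (X := {g : G | (g : G ⧸ H) = t})
      (by rintro g rfl; simp) ha (coe_mem_component hM hsys hE ψ)
    rw [← actionMap_tmul, hsys.mem_component_iff] at h
    rw [SetLike.mem_coe, Submodule.mem_orthogonal_singleton_iff_inner_right, ← hU, ← map_sub,
      U.inner_map_map, ← h, inner_sub_left, hsys.inner_apply, hsys.apply_apply, sub_self]

end Core

end

/-! ### Recovering a representation from the system it induces -/

section

variable {G : Type*} [Group G] {A : Type*} [Ring A] [StarRing A] [Algebra ℂ A] [StarModule ℂ A]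
  {𝒢 : StarGrading G A} {H : Subgroup G}

theorem WellBehavedSub.isClosedRep {L : Type*} [NormedAddCommGroup L] [InnerProductSpace ℂ L]
    [CompleteSpace L] {ρ : StarRep (𝒢.sub H) L} (h : WellBehavedSub 𝒢 H ρ) : ρ.IsClosedRep :=
  h.choose_spec.1.1.1.of_comp

theorem WellBehavedSub.toHom_one {L : Type*} [NormedAddCommGroup L] [InnerProductSpace ℂ L]
    [CompleteSpace L] {ρ : StarRep (𝒢.sub H) L} (h : WellBehavedSub 𝒢 H ρ) (φ : ρ.domain) :
    ρ.toHom 1 φ = φ :=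
  h.choose_spec.1.toHom_one φ

theorem StarGrading.condExp_one : 𝒢.condExp H 1 = 1 :=
  Subtype.ext (𝒢.proj_of_mem _ 𝒢.one_mem H.one_mem)

variable {L : Type*} [NormedAddCommGroup L] [InnerProductSpace ℂ L] {ρ : StarRep (𝒢.sub H) L}

theorem inner_indClass_one_tmul (hρ : Inducible 𝒢 H ρ) (φ ψ : ρ.domain) (x : A) :
    inner ℂ (indClass hρ (1 ⊗ₜ φ)) (indClass hρ (x ⊗ₜ ψ)) =
      inner ℂ (φ : L) (ρ.toHom (𝒢.condExp H x) ψ : L) := by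
  rw [inner_indClass, indForm_tmul, star_one, one_mul]

/-- Elements of `A_H` pass through the tensor sign modulo the kernel of the form. -/
theorem indClass_tmul_of_mem (hρ : Inducible 𝒢 H ρ) (b : 𝒢.sub H) (φ : ρ.domain) :
    indClass hρ ((b : A) ⊗ₜ φ) = indClass hρ (1 ⊗ₜ ρ.toHom b φ) := by
  refine (denseRange_indClass hρ).eq_of_inner_left (𝕜 := ℂ) fun ξ => ?_
  induction ξ with
  | zero => simp
  | add ξ η h h' => rw [map_add, inner_add_right, inner_add_right, h, h']
  | tmul y ψ =>
    rw [inner_indClass_one_tmul, inner_indClass, indForm_tmul, ρ.inner_toHom,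
      ← Module.End.mul_apply, ← map_mul, ← StarGrading.condExp_mul]
    rfl

theorem indClass_mem_domain (hρ : Inducible 𝒢 H ρ) (ξ : A ⊗[ℂ] ρ.domain) :
    indClass hρ ξ ∈ (ind hρ).domain :=
  (mem_domain_closureOfCore _ _).2 ⟨_, coreGraph_core _ _ ξ⟩

theorem ind_toHom_indClass (hρ : Inducible 𝒢 H ρ) (a : A) (ξ : A ⊗[ℂ] ρ.domain)
    (h : indClass hρ ξ ∈ (ind hρ).domain) :
    ((ind hρ).toHom a ⟨indClass hρ ξ, h⟩ : IndSpace hρ) = indClass hρ (indAction ρ a ξ) :=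
  closureOfCore_apply _ _ (coreGraph_core _ _ ξ) h a

theorem indProj_indClass_one_tmul (hρ : Inducible 𝒢 H ρ) (φ : ρ.domain) :
    indProj hρ ((1 : G) : G ⧸ H) (indClass hρ (1 ⊗ₜ φ)) = indClass hρ (1 ⊗ₜ φ) := by
  refine Submodule.starProjection_eq_self_iff.2 (Submodule.le_topologicalClosure _
    (Submodule.subset_span ⟨1, 𝒢.part_le_sum ?_ 𝒢.one_mem, φ, rfl⟩))
  rfl

/-- The map `x ⊗ φ ↦ ρ(p_H(x))φ` of `A ⊗ D(ρ)` into `D(ρ)`. -/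
noncomputable def condExpMap (ρ : StarRep (𝒢.sub H) L) : (A ⊗[ℂ] ρ.domain) →ₗ[ℂ] ρ.domain :=
  TensorProduct.lift (LinearMap.mk₂ ℂ (fun x φ => ρ.toHom (𝒢.condExp H x) φ)
    (fun x y φ => by simp) (fun c x φ => by simp) (fun x φ ψ => by simp) (fun c x φ => by simp))

theorem condExpMap_indAction (b : 𝒢.sub H) (ξ : A ⊗[ℂ] ρ.domain) :
    condExpMap ρ (indAction ρ b ξ) = ρ.toHom b (condExpMap ρ ξ) := by
  induction ξ with
  | zero => simp
  | add ξ η h h' => rw [map_add, map_add, h, h', map_add, map_add]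
  | tmul x φ =>
    change ρ.toHom (𝒢.condExp H (b * x)) φ = ρ.toHom b (ρ.toHom (𝒢.condExp H x) φ)
    rw [StarGrading.condExp_mul, map_mul]
    rfl

/-- The extension `J` of `φ ↦ [1 ⊗ φ]` to the whole Hilbert space of `ρ`. -/
theorem exists_isometric_embedding (hρ : Inducible 𝒢 H ρ) (h1 : ∀ φ, ρ.toHom 1 φ = φ) :
    ∃ J : L →L[ℂ] IndSpace hρ, (∀ φ : ρ.domain, J φ = indClass hρ (1 ⊗ₜ φ)) ∧
      ∀ x, ‖J x‖ = ‖x‖ := by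
  have hd : DenseRange ρ.domain.subtype := by
    simpa [DenseRange] using ρ.dense
  have hn : ∀ φ : ρ.domain, ‖indClass hρ (1 ⊗ₜ φ)‖ = ‖(φ : L)‖ := fun φ => by
    rw [norm_eq_sqrt_re_inner (𝕜 := ℂ), inner_indClass_one_tmul, StarGrading.condExp_one, h1,
      ← norm_eq_sqrt_re_inner (𝕜 := ℂ)]
  let f : ρ.domain →ₗ[ℂ] IndSpace hρ := indClass hρ ∘ₗ TensorProduct.mk ℂ A ρ.domain 1
  have hJ : ∀ φ : ρ.domain, f.extendOfNorm ρ.domain.subtype φ = indClass hρ (1 ⊗ₜ φ) := fun φ =>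
    LinearMap.extendOfNorm_eq hd ⟨1, fun φ => by rw [one_mul]; exact (hn φ).le⟩ φ
  refine ⟨f.extendOfNorm ρ.domain.subtype, hJ, fun x => ?_⟩
  refine hd.induction ?_ (isClosed_eq (by fun_prop) (by fun_prop)) x
  rintro _ ⟨φ, rfl⟩
  exact (congrArg _ (hJ φ)).trans (hn φ)

variable [CompleteSpace L] {hρ : Inducible 𝒢 H ρ} {J : L →L[ℂ] IndSpace hρ}

/-- The adjoint of the embedding `φ ↦ [1 ⊗ φ]` is induced by the conditional expectation. -/
theorem adjoint_indClass (hJ : ∀ φ : ρ.domain, J φ = indClass hρ (1 ⊗ₜ φ))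
    (ξ : A ⊗[ℂ] ρ.domain) :
    ContinuousLinearMap.adjoint J (indClass hρ ξ) = condExpMap ρ ξ := by
  refine ρ.dense.eq_of_inner_right (𝕜 := ℂ) fun φ hφ => ?_
  rw [ContinuousLinearMap.adjoint_inner_right, hJ ⟨φ, hφ⟩]
  induction ξ with
  | zero => simp
  | add ξ η h h' => rw [map_add, inner_add_right, h, h', map_add, ← inner_add_right]; rfl
  | tmul x ψ => exact inner_indClass_one_tmul hρ ⟨φ, hφ⟩ ψ x

/-- A continuous map that sends `[x ⊗ φ]` to `ρ(p_H(x))φ` sends the domain of `Ind ρ` into the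
domain of a closed `ρ`: it maps the graph of `Ind ρ`, restricted to `A_H`, into that of `ρ`. -/
theorem mem_domain_of_apply_indClass (hcl : ρ.IsClosedRep) {P : IndSpace hρ →L[ℂ] L}
    (hP : ∀ ξ, P (indClass hρ ξ) = condExpMap ρ ξ) {η : IndSpace hρ}
    (hη : η ∈ (ind hρ).domain) : P η ∈ ρ.domain := by
  obtain ⟨Φ, h⟩ : ∃ Φ, (η, Φ) ∈ coreGraph (indClass hρ) (indAction ρ) :=
    (mem_domain_closureOfCore _ _).1 hη
  have hmap : (P η, fun b : 𝒢.sub H => P (Φ b)) ∈ closure (Set.range ρ.graphMap) := by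
    refine map_mem_closure (f := fun q : IndSpace hρ × (A → IndSpace hρ) =>
      (P q.1, fun b : 𝒢.sub H => P (q.2 b))) (by fun_prop) h ?_
    rintro _ ⟨ξ, rfl⟩
    refine ⟨condExpMap ρ ξ, Prod.ext (hP ξ).symm (funext fun b => ?_)⟩
    change (ρ.toHom b (condExpMap ρ ξ) : L) = P (indClass hρ (indAction ρ b ξ))
    rw [hP, condExpMap_indAction]
  exact ρ.isClosedRep_iff.1 hcl _ hmap

/-- `J J^*` fixes the range of the projection attached to the coset `H`. -/
theorem apply_adjoint_of_indProj_eq_self (hJ : ∀ φ : ρ.domain, J φ = indClass hρ (1 ⊗ₜ φ))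
    {η : IndSpace hρ} (hη : indProj hρ ((1 : G) : G ⧸ H) η = η) :
    J (ContinuousLinearMap.adjoint J η) = η := by
  have hle : (Submodule.span ℂ {ξ : IndSpace hρ | ∃ a ∈ 𝒢.sum {g : G | (g : G ⧸ H) = (1 : G)},
      ∃ φ : ρ.domain, ξ = indClass hρ (a ⊗ₜ φ)}).topologicalClosure ≤
      LinearMap.eqLocus (J ∘L ContinuousLinearMap.adjoint J).toLinearMap LinearMap.id := by
    refine Submodule.topologicalClosure_minimal _ (Submodule.span_le.2 ?_)
      (isClosed_eq (J ∘L ContinuousLinearMap.adjoint J).continuous continuous_id)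
    rintro _ ⟨a, ha, φ, rfl⟩
    rw [setOf_mk_eq_one] at ha
    change J (ContinuousLinearMap.adjoint J (indClass hρ (a ⊗ₜ φ))) = indClass hρ (a ⊗ₜ φ)
    rw [adjoint_indClass hJ, hJ]
    change indClass hρ (1 ⊗ₜ ρ.toHom (𝒢.condExp H a) φ) = _
    rw [← indClass_tmul_of_mem]
    exact congrArg (fun b => indClass hρ (b ⊗ₜ φ)) (StarGrading.proj_eq_self ha)
  exact hle (Submodule.starProjection_eq_self_iff.1 hη)

/-- A closed unital representation whose induced system is equivalent to `(π, E)` is equivalent to the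
part of `π` on `Ran E(H)`. -/
theorem equivalent_reduce_of_systemEquivalent {K : Type*} [NormedAddCommGroup K]
    [InnerProductSpace ℂ K] [CompleteSpace K] {π : StarRep A K} {E : G ⧸ H → (K →L[ℂ] K)}
    {M : Submodule ℂ K} [M.HasOrthogonalProjection]
    (hM : ∀ a, (π.comp (𝒢.sub H).subtype).Intertwines a M.starProjection M.starProjection)
    (hE : E ((1 : G) : G ⧸ H) = M.starProjection) (hcl : ρ.IsClosedRep)
    (h1 : ∀ φ, ρ.toHom 1 φ = φ) (hequiv : SystemEquivalent π E (ind hρ) (indProj hρ)) :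
    ρ.Equivalent ((π.comp (𝒢.sub H).subtype).reduce M hM) := by
  obtain ⟨U, hdom, hact, hproj⟩ := hequiv
  obtain ⟨J, hJ, hnorm⟩ := exists_isometric_embedding hρ h1
  have hJdom : ∀ φ : ρ.domain, J φ ∈ (ind hρ).domain := fun φ => hJ φ ▸ indClass_mem_domain hρ _
  have hmemD : ∀ φ : ρ.domain, U.symm (J φ) ∈ π.domain := fun φ => by
    rw [hdom, U.apply_symm_apply]
    exact hJdom φ
  have hmemM : ∀ φ : ρ.domain, U.symm (J φ) ∈ M := fun φ => by
    rw [← Submodule.starProjection_eq_self_iff, ← hE, ← U.injective.eq_iff, hproj,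
      U.apply_symm_apply, hJ, indProj_indClass_one_tmul]
  let V : ρ.domain →ₗᵢ[ℂ] ((π.comp (𝒢.sub H).subtype).reduce M hM).domain :=
    { toLinearMap := ((U.symm.toLinearEquiv.toLinearMap ∘ₗ J.toLinearMap ∘ₗ
        ρ.domain.subtype).codRestrict M hmemM).codRestrict _ hmemD
      norm_map' := fun φ => (U.symm.norm_map (J φ)).trans (hnorm φ) }
  have hV : ∀ φ, ((V φ : M) : K) = U.symm (J φ) := fun φ => rfl
  have hsurj : Function.Surjective V := by
    intro ψ
    have hη : U (ψ : M) ∈ (ind hρ).domain := (hdom _).1 ψ.2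
    have hfix : indProj hρ ((1 : G) : G ⧸ H) (U (ψ : M)) = U (ψ : M) := by
      rw [← hproj, hE, M.starProjection_mem_subspace_eq_self]
    refine ⟨⟨_, mem_domain_of_apply_indClass hcl (adjoint_indClass hJ) hη⟩, Subtype.ext (Subtype.ext ?_)⟩
    rw [hV, apply_adjoint_of_indProj_eq_self hJ hfix, U.symm_apply_apply]
  refine ⟨LinearIsometryEquiv.ofSurjective V hsurj, fun a φ => Subtype.ext (Subtype.ext ?_)⟩
  change U.symm (J (ρ.toHom a φ)) = (π.toHom a ⟨U.symm (J φ), hmemD φ⟩ : K)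
  have hUJ : U (U.symm (J φ)) ∈ (ind hρ).domain := by
    rw [U.apply_symm_apply]
    exact hJdom φ
  rw [U.symm_apply_eq, hact a ⟨_, hmemD φ⟩ hUJ, hJ, ← indClass_tmul_of_mem]
  have hval : (⟨U (U.symm (J φ)), hUJ⟩ : (ind hρ).domain) =
      ⟨indClass hρ (1 ⊗ₜ φ), indClass_mem_domain hρ _⟩ :=
    Subtype.ext ((U.apply_symm_apply _).trans (hJ φ))
  rw [hval, ind_toHom_indClass]
  change _ = indClass hρ (((a : A) * 1) ⊗ₜ φ)
  rw [mul_one]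

end

end Imprim

theorem mainTheorem3
    {G : Type*} [Group G]
    {A : Type*} [Ring A] [StarRing A] [Algebra ℂ A] [StarModule ℂ A]
    (𝒢 : StarGrading G A)
    (hcomm : ∀ a ∈ 𝒢.base, ∀ b ∈ 𝒢.base, a * b = b * a)
    (hcount : 𝒢.BaseCountablyGenerated)
    (H : Subgroup G)
    {K : Type v} [NormedAddCommGroup K] [InnerProductSpace ℂ K] [CompleteSpace K]
    (π : StarRep A K) (E : G ⧸ H → (K →L[ℂ] K))
    (hsys : IsSystem 𝒢 π E)
    (hwell : IsWellBehavedSystem 𝒢 π E)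
    (hnondeg : IsNondegenerate 𝒢 π E) :
    ∃ (L : Type v) (_ : NormedAddCommGroup L) (_ : InnerProductSpace ℂ L) (_ : CompleteSpace L)
      (ρ : StarRep (𝒢.sub H) L) (hρ : Inducible 𝒢 H ρ),
      (WellBehavedSub 𝒢 H ρ ∧ SystemEquivalent π E (ind hρ) (indProj hρ)) ∧
      ∀ (L' : Type w) (_ : NormedAddCommGroup L') (_ : InnerProductSpace ℂ L')
        (_ : CompleteSpace L') (ρ' : StarRep (𝒢.sub H) L') (hρ' : Inducible 𝒢 H ρ'),
        WellBehavedSub 𝒢 H ρ' → SystemEquivalent π E (ind hρ') (indProj hρ') →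
        ρ'.Equivalent ρ := by
  obtain ⟨F, hF, hEF⟩ := hwell
  let t : G ⧸ H := ((1 : G) : G ⧸ H)
  obtain ⟨_, hE⟩ := isStarProjection_iff_eq_starProjection_range.1 (hsys.isStarProjection t)
  let M : Submodule ℂ K := (E t).range
  have hmemM : ∀ x : K, x ∈ M ↔ E t x = x := fun x => by
    rw [hE]
    exact Submodule.starProjection_eq_self_iff.symm
  have hMc : IsClosed (M : Set K) := by
    rw [show (M : Set K) = {x | E t x = x} from Set.ext hmemM]
    exact isClosed_eq (E t).continuous continuous_id
  have : CompleteSpace M := hMc.completeSpace_coe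
  have hM : ∀ a, (π.comp (𝒢.sub H).subtype).Intertwines a M.starProjection M.starProjection := by
    intro a
    have := hsys.intertwines_sum (s := t) (t := t) (X := (H : Set G))
      (fun h hh => by simpa [t, QuotientGroup.eq] using hh) a.2
    rw [hE] at this
    exact this
  have hFM : ∀ s, MeasurableSet s → ∀ x ∈ M, F.proj s x ∈ M := fun s hs x hx => by
    rw [hmemM] at hx ⊢
    rw [← mul_apply_eq_comp, hEF t s hs, mul_apply_eq_comp, hx]
  refine ⟨M, inferInstance, inferInstance, inferInstance,
    (π.comp (𝒢.sub H).subtype).reduce M hM, inducible_reduce hM hsys hE,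
    ⟨hF.wellBehavedSub_reduce H M hM hFM,
      systemEquivalent_reduce hM hF.1.1.1.of_comp hsys hE hnondeg⟩, ?_⟩
  intro L' _ _ _ ρ' hρ' hwb hequiv
  exact equivalent_reduce_of_systemEquivalent hM hE hwb.isClosedRep hwb.toHom_one hequiv
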